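/- Let $q=p^r$ be a prime power and $\mathbb{F}_q$ the field with $q$ elements. For a monic polynomial $f\in\mathbb{F}_q[T]$ put $\Lambda_q(f)=\deg P$ if $f=P^k$ with $P$ monic irreducible and $k\ge 1$, and $\Lambda_q(f)=0$ otherwise. The $j$-th next-to-leading coefficient of $f$ is the coefficient of $T^{\deg f-j}$, and is taken to be $0$ if $j>\deg f$. For a positive integer $\ell$ and $n\ge 1$ let $$\psi_q(n,\underbrace{0,\ldots,0}_{\ell})=\sum_{f}\Lambda_q(f),$$ where $f$ runs over the monic polynomials of degree $n$ in $\mathbb{F}_q[T]$ whose first $\ell$ next-to-leading coefficients are all $0$, and define $$f_{q,\ell}(n)=\frac{\psi_q(n,0,\ldots,0)-q^{n-\ell}}{q^{n/2}}\qquad(n\in\mathbb{N}_{>0}).$$ If $\ell=3$ and $p\notin\{2,5\}$, or if $\ell\ge 4$, then $f_{q,\ell}$ is not periodic in $n$: there is no integer $N\ge 1$ such that $f_{q,\ell}(n+N)=f_{q,\ell}(n)$ for all $n\ge 1$. -/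

import Mathlib

open Polynomial

noncomputable section

namespace ShortInterval

/-- The `j`-th next-to-leading coefficient of `f`, that is the coefficient of `T ^ (deg f - j)`,
with the convention that it is `0` when `j > deg f`. -/
def nextToLeadingCoeff {F : Type*} [Field F] (f : F[X]) (j : ℕ) : F :=
  if j ≤ f.natDegree then f.coeff (f.natDegree - j) else 0

open Classical in
/-- The von Mangoldt function: `Λ(P ^ k) = deg P` for `P` monic irreducible and `k ≥ 1`, and
`Λ(f) = 0` if `f` is not of this form. (By unique factorization, `P` is determined by `f`.) -/
def vonMangoldt {F : Type*} [Field F] (f : F[X]) : ℂ :=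
  if h : ∃ P : F[X], P.Monic ∧ Irreducible P ∧ ∃ k : ℕ, 1 ≤ k ∧ f = P ^ k then
    (h.choose.natDegree : ℂ)
  else 0

/-- The monic polynomials of degree `n` whose first `ℓ` next-to-leading coefficients are
`t 0, …, t (ℓ - 1)`. -/
def monicWithCoeffs (F : Type*) [Field F] (n : ℕ) {ℓ : ℕ} (t : Fin ℓ → F) : Set F[X] :=
  {f | f.Monic ∧ f.natDegree = n ∧ ∀ i : Fin ℓ, nextToLeadingCoeff f (i + 1) = t i}

theorem monicWithCoeffs_finite (F : Type*) [Field F] [Fintype F] (n : ℕ) {ℓ : ℕ}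
    (t : Fin ℓ → F) : (monicWithCoeffs F n t).Finite := by
  refine Set.Finite.of_finite_image
    (f := fun (f : F[X]) (i : Fin (n + 1)) => f.coeff i) (Set.toFinite _) ?_
  intro f hf g hg hfg
  ext m
  by_cases hm : m < n + 1
  · exact congrFun hfg ⟨m, hm⟩
  · rw [coeff_eq_zero_of_natDegree_lt (by have := hf.2.1; omega),
      coeff_eq_zero_of_natDegree_lt (by have := hg.2.1; omega)]

/-- `ψ_q(n, t_1, …, t_ℓ)`: the sum of the von Mangoldt function over the monic polynomials of
degree `n` over the finite field `F` with `q` elements whose first `ℓ` next-to-leading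
coefficients are `t_1, …, t_ℓ`. -/
def psi (F : Type*) [Field F] [Fintype F] (n : ℕ) {ℓ : ℕ} (t : Fin ℓ → F) : ℂ :=
  ∑ f ∈ (monicWithCoeffs_finite F n t).toFinset, vonMangoldt f

/-- `f_{q,ℓ}(n) = (ψ_q(n, 0, …, 0) - q ^ (n - ℓ)) / q ^ (n / 2)` for `n ≥ 1`, with `ℓ` zeros;
the exponent `n - ℓ` is an integer and `n / 2` a real number. -/
def normalizedPsi (F : Type*) [Field F] [Fintype F] (ℓ : ℕ) (n : ℕ+) : ℂ :=
  (psi F (n : ℕ) (fun _ : Fin ℓ => (0 : F)) -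
      (Fintype.card F : ℂ) ^ (((n : ℕ) : ℤ) - (ℓ : ℤ))) /
    (((Fintype.card F : ℝ) ^ (((n : ℕ) : ℝ) / 2) : ℝ) : ℂ)

end ShortInterval

end

/-! The monic polynomials, identified when their first `ℓ` next-to-leading coefficients agree, form
a finite abelian group of order `q ^ ℓ`. A nontrivial character `h` of it has a polynomial
`L`-function, so `mangoldtSum h n` is minus a sum of `n`-th powers of inverse zeros. Orthogonality
(`exists_multiset_psi`) then writes `q ^ ℓ * f_{q,ℓ}(n)` as minus the sum of `(γ / √q) ^ n`, with
`γ` running over the inverse zeros for all nontrivial characters. All coefficients have the same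
sign, so nothing cancels: by independence of geometric sequences, period `N` forces `(γ / √q) ^ N =
1` for every `γ` (`pow_eq_of_periodic`). The Riemann hypothesis is not needed.

A level character `h` over the prime field pulls back to `F` through the norm of polynomials, which
replaces its inverse zeros by their `r`-th powers, `r = [F : 𝔽_p]`. Periodicity therefore makes
every `γ / √p` a root of unity, and `(∑ c, h (X + C c)) ^ 2` is divisible by `p` among algebraic
integers (`exists_sq_eq_of_periodic`).

This divisibility is refuted for one explicit `h` per prime (`exists_levelChar_not_sq_eq`). Modulo
`p` the cyclotomic polynomial of level `p ^ k` is a power of `X - 1`, so divisibility forces small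
power sums of the exponents of the roots of unity to vanish (`sum_pow_eq_zero_of_sq_eq`). The chosen
characters violate this: values of order 8 for `p = 2` and order 9 for `p = 3`, a quartic
exponential sum for `p = 5`, a cubic one for `p ≥ 7`. -/

noncomputable section

namespace ShortInterval

/-! ### Von Mangoldt function and truncation of polynomials. -/

section Mangoldt

variable {F : Type*} [Field F]

theorem eq_of_monic_pow_eq_pow {P Q : F[X]} (hP : P.Monic) (hPi : Irreducible P)
    (hQ : Q.Monic) (hQi : Irreducible Q) {k j : ℕ} (hk : 1 ≤ k) (h : P ^ k = Q ^ j) : P = Q := by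
  have hdvd : P ∣ Q := by
    refine hPi.prime.dvd_of_dvd_pow (n := j) ?_
    rw [← h]
    exact dvd_pow_self P (by omega)
  exact eq_of_monic_of_associated hP hQ (hPi.associated_of_dvd hQi hdvd)

theorem vonMangoldt_pow {P : F[X]} (hP : P.Monic) (hPi : Irreducible P) {k : ℕ} (hk : 1 ≤ k) :
    vonMangoldt (P ^ k) = (P.natDegree : ℂ) := by
  have h : ∃ Q : F[X], Q.Monic ∧ Irreducible Q ∧ ∃ j : ℕ, 1 ≤ j ∧ P ^ k = Q ^ j :=
    ⟨P, hP, hPi, k, hk, rfl⟩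
  rw [vonMangoldt, dif_pos h]
  obtain ⟨hm, hi, j, hj, e⟩ := h.choose_spec
  rw [← eq_of_monic_pow_eq_pow hP hPi hm hi hk e]

theorem vonMangoldt_eq_zero {f : F[X]}
    (h : ¬ ∃ P : F[X], P.Monic ∧ Irreducible P ∧ ∃ k : ℕ, 1 ≤ k ∧ f = P ^ k) :
    vonMangoldt f = 0 := by
  rw [vonMangoldt, dif_neg h]

theorem vonMangoldt_X_add_C (c : F) : vonMangoldt (X + C c) = 1 := by
  have := vonMangoldt_pow (monic_X_add_C c) (irreducible_of_degree_eq_one (degree_X_add_C c))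
    (le_refl 1)
  simpa using this

theorem coeff_divByMonic_X_pow (f : F[X]) (m i : ℕ) :
    (f /ₘ X ^ m).coeff i = f.coeff (i + m) := by
  have h := modByMonic_add_div f (X ^ m : F[X])
  have hr : (f %ₘ X ^ m).coeff (i + m) = 0 := by
    apply coeff_eq_zero_of_degree_lt
    refine (degree_modByMonic_lt f (monic_X_pow m)).trans_le ?_
    rw [degree_X_pow]
    exact_mod_cast Nat.le_add_left m i
  conv_rhs => rw [← h]
  rw [coeff_add, hr, zero_add, mul_comm, coeff_mul_X_pow]

theorem natDegree_divByMonic_X_pow (f : F[X]) (m : ℕ) :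
    (f /ₘ X ^ m).natDegree = f.natDegree - m := by
  rw [natDegree_divByMonic f (monic_X_pow m), natDegree_X_pow]

theorem monic_divByMonic_X_pow {f : F[X]} (hf : f.Monic) {m : ℕ} (h : m ≤ f.natDegree) :
    (f /ₘ X ^ m).Monic := by
  rw [Monic, leadingCoeff, coeff_divByMonic_X_pow, natDegree_divByMonic_X_pow,
    Nat.sub_add_cancel h]
  exact hf

theorem coeff_reverse_of_le {f : F[X]} {j : ℕ} (h : j ≤ f.natDegree) :
    f.reverse.coeff j = f.coeff (f.natDegree - j) := by
  rw [coeff_reverse, revAt_le h]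

theorem coeff_reverse_divByMonic_X_pow (f : F[X]) {m j : ℕ} (h : j + m ≤ f.natDegree) :
    (f /ₘ X ^ m).reverse.coeff j = f.reverse.coeff j := by
  rw [coeff_reverse_of_le (by rw [natDegree_divByMonic_X_pow]; omega),
    coeff_reverse_of_le (by omega), coeff_divByMonic_X_pow, natDegree_divByMonic_X_pow]
  congr 1
  omega

end Mangoldt

/-! ### Sums of level characters over monic polynomials. -/

section Finite

variable (F : Type*) [Field F] [Fintype F]

/-- The finset of monic polynomials of degree `n`. -/
def monicOfDegree (n : ℕ) : Finset F[X] :=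
  (monicWithCoeffs_finite F n (Fin.elim0 : Fin 0 → F)).toFinset

variable {F}

@[simp]
theorem mem_monicOfDegree {n : ℕ} {f : F[X]} :
    f ∈ monicOfDegree F n ↔ f.Monic ∧ f.natDegree = n := by
  simp [monicOfDegree, monicWithCoeffs]

open Classical in
/-- `∑_{de = f} Λ(d) = deg f`, the sum over factorizations into monic polynomials. -/
theorem sum_vonMangoldt_factorizations {n : ℕ} {f : F[X]} (hf : f ∈ monicOfDegree F n) :
    ∑ x ∈ ((Finset.HasAntidiagonal.antidiagonal n).sigma
        fun km => monicOfDegree F km.1 ×ˢ monicOfDegree F km.2) with x.2.1 * x.2.2 = f,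
      vonMangoldt x.2.1 = (n : ℂ) := by
  obtain ⟨hfm, hfn⟩ := mem_monicOfDegree.1 hf
  set s := UniqueFactorizationMonoid.normalizedFactors f with hs
  have hsm : ∀ P ∈ s, P.Monic := fun P hP => by
    rw [← UniqueFactorizationMonoid.normalize_normalized_factor P hP]
    exact monic_normalize (UniqueFactorizationMonoid.irreducible_of_normalized_factor P hP).ne_zero
  have hsi : ∀ P ∈ s, Irreducible P :=
    fun P hP => UniqueFactorizationMonoid.irreducible_of_normalized_factor P hP
  have hprod : s.prod = f := by
    rw [hs, UniqueFactorizationMonoid.prod_normalizedFactors_eq hfm.ne_zero, hfm.normalize_eq_self]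
  have hdvd : ∀ P, P.Monic → Irreducible P → ∀ k, P ^ k ∣ f ↔ k ≤ s.count P := by
    intro P hP hPi k
    rw [Multiset.le_count_iff_replicate_le,
      UniqueFactorizationMonoid.dvd_iff_normalizedFactors_le_normalizedFactors
        (hP.pow k).ne_zero hfm.ne_zero, hPi.normalizedFactors_pow, hP.normalize_eq_self]
  have hdeg : (n : ℂ) = ∑ P ∈ s.toFinset, ∑ _k ∈ Finset.Icc 1 (s.count P), (P.natDegree : ℂ) := by
    have h1 : n = ∑ P ∈ s.toFinset, s.count P * P.natDegree := by
      rw [← hfn, ← hprod, natDegree_multiset_prod_of_monic _ hsm, Finset.sum_multiset_map_count]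
      simp
    rw [h1]
    simp
  rw [hdeg, Finset.sum_sigma', eq_comm]
  -- The factorizations with nonzero weight are those with `d = P ^ k`, where `P` is a prime factor
  -- and `k` is between 1 and its multiplicity.
  refine Finset.sum_of_injOn
    (fun x : Σ _ : F[X], ℕ =>
      (⟨((x.1 ^ x.2).natDegree, (f / x.1 ^ x.2).natDegree), (x.1 ^ x.2, f / x.1 ^ x.2)⟩ :
        Σ _ : ℕ × ℕ, F[X] × F[X])) ?_ ?_ ?_ ?_
  · rintro ⟨P, k⟩ hx ⟨Q, j⟩ hy e
    simp only [Finset.coe_sigma, Set.mem_sigma_iff, Finset.mem_coe, Multiset.mem_toFinset,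
      Finset.mem_Icc] at hx hy
    simp only [Sigma.mk.injEq, heq_eq_eq, Prod.mk.injEq] at e
    have hPQ := eq_of_monic_pow_eq_pow (hsm P hx.1) (hsi P hx.1) (hsm Q hy.1)
      (hsi Q hy.1) hx.2.1 e.2.1
    subst hPQ
    have h2 := e.1.1
    rw [natDegree_pow, natDegree_pow] at h2
    have := Nat.eq_of_mul_eq_mul_right (hsi P hx.1).natDegree_pos h2
    rw [this]
  · rintro ⟨P, k⟩ hx
    simp only [Finset.coe_sigma, Set.mem_sigma_iff, Finset.mem_coe, Multiset.mem_toFinset,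
      Finset.mem_Icc] at hx
    have hPk := (hsm P hx.1).pow k
    have hd : P ^ k ∣ f := (hdvd P (hsm P hx.1) (hsi P hx.1) k).2 hx.2.2
    have hmul : P ^ k * (f / P ^ k) = f := EuclideanDomain.mul_div_cancel' hPk.ne_zero hd
    have hm2 : (f / P ^ k).Monic := hPk.of_mul_monic_left (by rw [hmul]; exact hfm)
    have hdeg2 : (P ^ k).natDegree + (f / P ^ k).natDegree = n := by
      rw [← hPk.natDegree_mul hm2, hmul, hfn]
    simp only [Finset.coe_filter, Finset.mem_sigma, Finset.HasAntidiagonal.mem_antidiagonal, Finset.mem_product,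
      mem_monicOfDegree, Set.mem_ofPred_eq]
    exact ⟨⟨hdeg2, ⟨hPk, trivial⟩, hm2, trivial⟩, hmul⟩
  · rintro ⟨⟨k, m⟩, d, e⟩ hx hnot
    simp only [Finset.mem_filter, Finset.mem_sigma, Finset.HasAntidiagonal.mem_antidiagonal, Finset.mem_product,
      mem_monicOfDegree] at hx
    obtain ⟨⟨-, ⟨hd, rfl⟩, he, rfl⟩, hde⟩ := hx
    refine vonMangoldt_eq_zero ?_
    rintro ⟨P, hP, hPi, j, hj, rfl⟩
    apply hnot
    have hle : j ≤ s.count P := (hdvd P hP hPi j).1 ⟨e, hde.symm⟩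
    refine ⟨⟨P, j⟩, ?_, ?_⟩
    · simp only [Finset.coe_sigma, Set.mem_sigma_iff, Finset.mem_coe, Multiset.mem_toFinset,
        Finset.mem_Icc]
      exact ⟨Multiset.count_pos.1 (by omega), hj, hle⟩
    · have : f / P ^ j = e := by
        rw [← hde]
        exact mul_div_cancel_left₀ _ hd.ne_zero
      simp [this]
  · rintro ⟨P, k⟩ hx
    simp only [Finset.mem_sigma, Multiset.mem_toFinset, Finset.mem_Icc] at hx
    exact (vonMangoldt_pow (hsm P hx.1) (hsi P hx.1) hx.2.1).symm

/-- A function on monic polynomials that is completely multiplicative and depends only on the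
first `ℓ` next-to-leading coefficients. -/
structure IsLevelChar (ℓ : ℕ) (h : F[X] → ℂ) : Prop where
  map_one : h 1 = 1
  map_mul : ∀ f g : F[X], f.Monic → g.Monic → h (f * g) = h f * h g
  congr : ∀ f g : F[X], f.Monic → g.Monic →
    (∀ j ≤ ℓ, f.reverse.coeff j = g.reverse.coeff j) → h f = h g

/-- The sum of `h` over the monic polynomials of degree `n`. -/
def monicSum (h : F[X] → ℂ) (n : ℕ) : ℂ := ∑ f ∈ monicOfDegree F n, h f

/-- The sum of `Λ h` over the monic polynomials of degree `n`. -/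
def mangoldtSum (h : F[X] → ℂ) (n : ℕ) : ℂ := ∑ f ∈ monicOfDegree F n, vonMangoldt f * h f

theorem monicOfDegree_zero : monicOfDegree F 0 = {1} := by
  ext f
  simp only [mem_monicOfDegree, Finset.mem_singleton]
  constructor
  · rintro ⟨h, h0⟩
    exact h.natDegree_eq_zero.1 h0
  · rintro rfl
    simp

theorem monicOfDegree_one_sum (g : F[X] → ℂ) :
    ∑ f ∈ monicOfDegree F 1, g f = ∑ c : F, g (X + C c) := by
  symm
  refine Finset.sum_bij (fun c _ => X + C c) ?_ ?_ ?_ ?_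
  · intro c _
    exact mem_monicOfDegree.2 ⟨monic_X_add_C c, natDegree_X_add_C c⟩
  · intro a _ b _ h
    simpa using h
  · intro f hf
    obtain ⟨hm, h1⟩ := mem_monicOfDegree.1 hf
    refine ⟨f.coeff 0, Finset.mem_univ _, ?_⟩
    conv_rhs => rw [eq_X_add_C_of_natDegree_le_one h1.le]
    have : f.coeff 1 = 1 := by rw [← h1]; exact hm
    simp [this]
  · intros; rfl

theorem monicSum_zero {ℓ : ℕ} {h : F[X] → ℂ} (hh : IsLevelChar ℓ h) : monicSum h 0 = 1 := by
  simp [monicSum, monicOfDegree_zero, hh.map_one]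

theorem mangoldtSum_one (h : F[X] → ℂ) : mangoldtSum h 1 = ∑ c : F, h (X + C c) := by
  rw [mangoldtSum, monicOfDegree_one_sum]
  simp [vonMangoldt_X_add_C]

/-- Coefficient form of `T L' = L * ∑ mangoldtSum h n T ^ n`, obtained by weighting `deg f = ∑ Λ(d)`
over `d ∣ f` with `h f`. -/
theorem natCast_mul_monicSum {ℓ : ℕ} {h : F[X] → ℂ} (hh : IsLevelChar ℓ h) (n : ℕ) :
    (n : ℂ) * monicSum h n =
      ∑ km ∈ Finset.HasAntidiagonal.antidiagonal n, mangoldtSum h km.1 * monicSum h km.2 := by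
  classical
  have h1 : ∀ km ∈ Finset.HasAntidiagonal.antidiagonal n, mangoldtSum h km.1 * monicSum h km.2 =
      ∑ x ∈ monicOfDegree F km.1 ×ˢ monicOfDegree F km.2, vonMangoldt x.1 * h (x.1 * x.2) := by
    intro km _
    rw [mangoldtSum, monicSum, Finset.sum_mul_sum, ← Finset.sum_product']
    refine Finset.sum_congr rfl ?_
    intro x hx
    simp only [Finset.mem_product, mem_monicOfDegree] at hx
    rw [hh.map_mul _ _ hx.1.1 hx.2.1]
    ring
  rw [Finset.sum_congr rfl h1, Finset.sum_sigma', monicSum, Finset.mul_sum]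
  rw [← Finset.sum_fiberwise_of_maps_to (t := monicOfDegree F n)
    (g := fun x : (Σ _ : ℕ × ℕ, F[X] × F[X]) => x.2.1 * x.2.2)]
  · refine Finset.sum_congr rfl ?_
    intro f hf
    rw [← sum_vonMangoldt_factorizations hf, Finset.sum_mul]
    refine Finset.sum_congr rfl ?_
    intro x hx
    rw [(Finset.mem_filter.1 hx).2]
  · rintro ⟨⟨k, m⟩, d, e⟩ hx
    simp only [Finset.mem_sigma, Finset.HasAntidiagonal.mem_antidiagonal, Finset.mem_product,
      mem_monicOfDegree] at hx ⊢
    obtain ⟨hkm, ⟨hd, rfl⟩, he, rfl⟩ := hx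
    exact ⟨hd.mul he, by rw [hd.natDegree_mul he, hkm]⟩

/-- Multiplying by `g` and discarding the lowest `deg g` coefficients permutes the monic polynomials
of degree `n`. For `n ≥ ℓ` the truncation does not affect the level, so the sum is unchanged when
multiplied by `h g ≠ 1`. -/
theorem monicSum_eq_zero {ℓ : ℕ} {h : F[X] → ℂ} (hh : IsLevelChar ℓ h) {g : F[X]} (hg : g.Monic)
    (hne : h g ≠ 1) {n : ℕ} (hn : ℓ ≤ n) : monicSum h n = 0 := by
  have hmaps : ∀ f ∈ monicOfDegree F n, (f * g) /ₘ X ^ g.natDegree ∈ monicOfDegree F n := by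
    intro f hf
    obtain ⟨hm, hd⟩ := mem_monicOfDegree.1 hf
    refine mem_monicOfDegree.2 ⟨monic_divByMonic_X_pow (hm.mul hg) ?_, ?_⟩
    · rw [hm.natDegree_mul hg]; omega
    · rw [natDegree_divByMonic_X_pow, hm.natDegree_mul hg, hd]; omega
  have hinj : Set.InjOn (fun f => (f * g) /ₘ X ^ g.natDegree) (monicOfDegree F n) := by
    intro f _ f' _ e
    by_contra hff
    -- The leading term of `(f - f') * g` sits in degree at least `deg g`, so it survives
    -- truncation.
    have h0 : f - f' ≠ 0 := sub_ne_zero.2 hff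
    have hdeg : ((f - f') * g).natDegree = (f - f').natDegree + g.natDegree :=
      natDegree_mul h0 hg.ne_zero
    have hc : ((f - f') * g).coeff ((f - f').natDegree + g.natDegree) = 0 := by
      have := congrArg (fun P : F[X] => P.coeff (f - f').natDegree) e
      simp only [coeff_divByMonic_X_pow] at this
      rw [sub_mul, coeff_sub, this, sub_self]
    rw [← hdeg, coeff_natDegree, leadingCoeff_eq_zero] at hc
    exact mul_ne_zero h0 hg.ne_zero hc
  have hbij := Finset.sum_of_injOn (s := monicOfDegree F n) (t := monicOfDegree F n)
    (f := fun f => h ((f * g) /ₘ X ^ g.natDegree)) (g := h)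
    (fun f => (f * g) /ₘ X ^ g.natDegree) hinj (fun f hf => hmaps f hf)
    (by
      intro i hi hni
      exact absurd (Finset.surjOn_of_injOn_of_card_le _ hmaps hinj le_rfl hi) hni)
    (fun _ _ => rfl)
  have hval : ∀ f ∈ monicOfDegree F n, h ((f * g) /ₘ X ^ g.natDegree) = h f * h g := by
    intro f hf
    have hf' := mem_monicOfDegree.1 (hmaps f hf)
    obtain ⟨hm, hd⟩ := mem_monicOfDegree.1 hf
    rw [← hh.map_mul f g hm hg]
    refine hh.congr _ _ hf'.1 (hm.mul hg) ?_
    intro j hj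
    refine coeff_reverse_divByMonic_X_pow _ ?_
    rw [hm.natDegree_mul hg]
    omega
  rw [Finset.sum_congr rfl hval, ← Finset.sum_mul] at hbij
  change monicSum h n * h g = monicSum h n at hbij
  have : monicSum h n * (h g - 1) = 0 := by rw [mul_sub, hbij]; ring
  exact (mul_eq_zero.1 this).resolve_right (sub_ne_zero.2 hne)

end Finite

/-! ### Newton's identities and independence of geometric sequences. -/

section PowerSums

theorem exists_multiset_prod_one_sub (L : ℂ[X]) (h0 : L.coeff 0 = 1) :
    ∃ s : Multiset ℂ, 0 ∉ s ∧ L = (s.map fun γ => (1 - C γ * X : ℂ[X])).prod := by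
  have hne : L ≠ 0 := by rintro rfl; simp at h0
  have hsplit := IsAlgClosed.splits L
  have h0r : (0 : ℂ) ∉ L.roots := by
    intro h
    rw [mem_roots hne, IsRoot, ← coeff_zero_eq_eval_zero, h0] at h
    exact one_ne_zero h
  refine ⟨L.roots.map fun x => x⁻¹, ?_, ?_⟩
  · intro h
    obtain ⟨x, hx, e⟩ := Multiset.mem_map.1 h
    rw [inv_eq_zero] at e
    exact h0r (e ▸ hx)
  · have key : ∀ s : Multiset ℂ, 0 ∉ s →
        (s.map fun x => (X - C x : ℂ[X])).prod =
          C ((s.map fun x => -x).prod) * ((s.map fun x => x⁻¹).map fun γ =>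
            (1 - C γ * X : ℂ[X])).prod := by
      intro s
      induction s using Multiset.induction with
      | empty => simp
      | cons a s ih =>
        intro h
        simp only [Multiset.mem_cons, not_or] at h
        have ha : a ≠ 0 := fun e => h.1 e.symm
        simp only [Multiset.map_cons, Multiset.prod_cons]
        rw [ih h.2]
        have : (X - C a : ℂ[X]) = C (-a) * (1 - C a⁻¹ * X) := by
          rw [mul_sub, ← mul_assoc, ← C_mul]
          simp [ha]
          ring
        rw [this, C_mul]
        ring
    have h1 := hsplit.eq_prod_roots
    rw [key _ h0r, ← mul_assoc, ← C_mul] at h1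
    set c := L.leadingCoeff * (L.roots.map fun x => -x).prod
    have h2 : ∀ s : Multiset ℂ,
        ((s.map fun γ => (1 - C γ * X : ℂ[X])).prod).coeff 0 = 1 := by
      intro s
      rw [coeff_zero_eq_eval_zero, eval_multiset_prod]
      simp
    have hc : c = 1 := by
      have := congrArg (fun P : ℂ[X] => P.coeff 0) h1
      simp only [coeff_C_mul, h2, h0] at this
      simpa using this.symm
    rw [hc, C_1, one_mul] at h1
    exact h1

/-- Logarithmic derivative of the product, one geometric series for each factor. -/
theorem mul_derivative_prod_one_sub (s : Multiset ℂ) :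
    (PowerSeries.X : PowerSeries ℂ) * (PowerSeries.derivative ℂ)
        (((s.map fun γ => (1 - C γ * X : ℂ[X])).prod : ℂ[X]) : PowerSeries ℂ) =
      -(((s.map fun γ => (1 - C γ * X : ℂ[X])).prod : ℂ[X]) : PowerSeries ℂ) *
        PowerSeries.mk fun n => if n = 0 then 0 else (s.map fun γ => γ ^ n).sum := by
  induction s using Multiset.induction with
  | empty =>
    have : (PowerSeries.mk fun _ => (0 : ℂ)) = 0 := by
      ext n; simp
    simp [this]
  | cons a s ih =>
    simp only [Multiset.map_cons, Multiset.prod_cons, Multiset.sum_cons]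
    set A := (s.map fun γ => (1 - C γ * X : ℂ[X])).prod
    have hsplit : (PowerSeries.mk fun n => if n = 0 then (0 : ℂ) else
          a ^ n + (s.map fun γ => γ ^ n).sum) =
        (PowerSeries.mk fun n => if n = 0 then (0 : ℂ) else a ^ n) +
        (PowerSeries.mk fun n => if n = 0 then (0 : ℂ) else (s.map fun γ => γ ^ n).sum) := by
      ext n
      by_cases h : n = 0 <;> simp [h]
    have hgeom : ((1 - C a * X : ℂ[X]) : PowerSeries ℂ) *
        (PowerSeries.mk fun n => if n = 0 then (0 : ℂ) else a ^ n) =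
          PowerSeries.C a * PowerSeries.X := by
      ext n
      rw [Polynomial.coe_sub, Polynomial.coe_one, Polynomial.coe_mul, Polynomial.coe_C,
        Polynomial.coe_X, sub_mul, one_mul, map_sub, mul_assoc, PowerSeries.coeff_C_mul,
        PowerSeries.coeff_C_mul]
      rcases n with _ | n
      · simp
      · rw [PowerSeries.coeff_succ_X_mul, PowerSeries.coeff_mk, PowerSeries.coeff_mk,
          PowerSeries.coeff_X]
        rcases n with _ | n
        · simp
        · simp [pow_succ]; ring
    have hder : (PowerSeries.derivative ℂ) ((1 - C a * X : ℂ[X]) : PowerSeries ℂ) =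
        - PowerSeries.C a := by
      rw [PowerSeries.derivative_coe]
      simp
    rw [hsplit, Polynomial.coe_mul, Derivation.leibniz, hder, smul_eq_mul, smul_eq_mul, mul_add,
      mul_left_comm, ih, mul_add]
    linear_combination (A : PowerSeries ℂ) * hgeom

/-- Newton's identities, solved for the power sums: a sequence `W` tied to the coefficients of a
polynomial `L` with `L(0) = 1` by `X L' = L W` is given by power sums. -/
theorem exists_multiset_of_recurrence (ℓ : ℕ) (a W : ℕ → ℂ) (ha0 : a 0 = 1)
    (ha : ∀ n, ℓ ≤ n → a n = 0)
    (hrec : ∀ n : ℕ, (n : ℂ) * a n = ∑ km ∈ Finset.HasAntidiagonal.antidiagonal n, W km.1 * a km.2) :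
    ∃ s : Multiset ℂ, 0 ∉ s ∧ ∀ n, 1 ≤ n → W n = -(s.map fun γ => γ ^ n).sum := by
  set L : ℂ[X] := ∑ i ∈ Finset.range ℓ, monomial i (a i) with hL
  have hcoeff : ∀ n, L.coeff n = a n := by
    intro n
    rw [hL, finsetSum_coeff]
    simp only [coeff_monomial]
    rw [Finset.sum_ite_eq' (Finset.range ℓ) n a]
    split_ifs with h
    · rfl
    · exact (ha n (by simpa using h)).symm
  obtain ⟨s, hs0, hs⟩ := exists_multiset_prod_one_sub L (by rw [hcoeff, ha0])
  refine ⟨s, hs0, ?_⟩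
  have h1 := mul_derivative_prod_one_sub s
  rw [← hs] at h1
  have h2 : (PowerSeries.X : PowerSeries ℂ) * (PowerSeries.derivative ℂ) (L : PowerSeries ℂ) =
      (L : PowerSeries ℂ) * PowerSeries.mk W := by
    ext n
    rw [mul_comm (L : PowerSeries ℂ), PowerSeries.coeff_mul n (PowerSeries.mk W)]
    simp only [PowerSeries.coeff_mk, Polynomial.coeff_coe, hcoeff]
    rw [← hrec n]
    rcases n with _ | n
    · simp
    · rw [PowerSeries.coeff_succ_X_mul, PowerSeries.coeff_derivative, Polynomial.coeff_coe, hcoeff]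
      push_cast
      ring
  have hLne : (L : PowerSeries ℂ) ≠ 0 := by
    intro h
    have := congrArg (PowerSeries.coeff 0) h
    rw [Polynomial.coeff_coe, hcoeff, ha0] at this
    simp at this
  rw [h2, neg_mul, ← mul_neg] at h1
  have h3 := mul_left_cancel₀ hLne h1
  intro n hn
  have := congrArg (PowerSeries.coeff n) h3
  simpa [show n ≠ 0 by omega] using this

theorem exists_mangoldtSum_eq {F : Type*} [Field F] [Fintype F] {ℓ : ℕ} {h : F[X] → ℂ}
    (hh : IsLevelChar ℓ h) {g : F[X]} (hg : g.Monic) (hne : h g ≠ 1) :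
    ∃ s : Multiset ℂ, 0 ∉ s ∧ ∀ n, 1 ≤ n → mangoldtSum h n = -(s.map fun γ => γ ^ n).sum :=
  exists_multiset_of_recurrence ℓ (monicSum h) (mangoldtSum h) (monicSum_zero hh)
    (fun _ hn => monicSum_eq_zero hh hg hne hn) (natCast_mul_monicSum hh)

/-- A vanishing combination of geometric sequences, with coefficients that depend only on the
ratio, has vanishing coefficients. -/
theorem eq_zero_of_sum_mul_pow_eq_zero (s : Multiset ℂ) (hs : 0 ∉ s) (c : ℂ → ℂ)
    (h : ∀ n, 1 ≤ n → (s.map fun δ => c δ * δ ^ n).sum = 0) : ∀ δ ∈ s, c δ = 0 := by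
  classical
  intro δ hδ
  have hli := (linearIndependent_monoidHom (Multiplicative ℕ) ℂ).comp
    (fun z : ℂ => (powersHom ℂ z)) (powersHom ℂ).injective
  -- Distinct homomorphisms `n ↦ z ^ n` are independent. The extra factor `z` shifts the hypothesis,
  -- known only from `n = 1`, to start at `0`; the multiplicity is nonzero in characteristic 0.
  have h1 := linearIndependent_iff'.1 hli s.toFinset (fun z => s.count z * c z * z) ?_ δ
    (Multiset.mem_toFinset.2 hδ)
  · have h2 : (s.count δ : ℂ) ≠ 0 := by
      exact_mod_cast (Multiset.count_pos.2 hδ).ne'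
    have h3 : δ ≠ 0 := fun e => hs (e ▸ hδ)
    simpa [h2, h3] using h1
  · funext n
    have := h (n.toAdd + 1) (by omega)
    rw [Finset.sum_multiset_map_count] at this
    rw [Finset.sum_apply, Pi.zero_apply, ← this]
    refine Finset.sum_congr rfl ?_
    intro z _
    simp [powersHom_apply, pow_succ]
    ring

end PowerSums

/-! ### The level group, its characters and the explicit formula. -/

section Duality

theorem coeff_reverse_mul_congr {F : Type*} [Field F] {ℓ : ℕ} {f g f' g' : F[X]}
    (h : ∀ j ≤ ℓ, f.reverse.coeff j = g.reverse.coeff j)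
    (h' : ∀ j ≤ ℓ, f'.reverse.coeff j = g'.reverse.coeff j) :
    ∀ j ≤ ℓ, (f * f').reverse.coeff j = (g * g').reverse.coeff j := by
  intro j hj
  simp only [reverse_mul_of_domain, coeff_mul]
  refine Finset.sum_congr rfl ?_
  intro x hx
  have := Finset.HasAntidiagonal.mem_antidiagonal.1 hx
  rw [h x.1 (by omega), h' x.2 (by omega)]

variable (F : Type*) [Field F]

/-- The monoid of monic polynomials. -/
def monics : Submonoid F[X] where
  carrier := {f | f.Monic}
  one_mem' := monic_one
  mul_mem' := fun ha hb => Monic.mul ha hb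

/-- Two monic polynomials are congruent at level `ℓ` if their first `ℓ` next-to-leading
coefficients agree. -/
def levelCon (ℓ : ℕ) : Con (monics F) where
  r f g := ∀ j ≤ ℓ, (f : F[X]).reverse.coeff j = (g : F[X]).reverse.coeff j
  iseqv := ⟨fun _ _ _ => rfl, fun h j hj => (h j hj).symm,
    fun h h' j hj => (h j hj).trans (h' j hj)⟩
  mul' := fun hab hcd => coeff_reverse_mul_congr hab hcd

/-- The group of classes of monic polynomials at level `ℓ`. -/
abbrev LevelQuot (ℓ : ℕ) : Type _ := (levelCon F ℓ).Quotient

variable {F}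

theorem levelQuot_mk_eq {ℓ : ℕ} {f g : monics F} :
    ((f : LevelQuot F ℓ) = g) ↔
      ∀ j ≤ ℓ, (f : F[X]).reverse.coeff j = (g : F[X]).reverse.coeff j :=
  Con.eq _

theorem coeff_reverse_one {j : ℕ} : (1 : F[X]).reverse.coeff j = if j = 0 then 1 else 0 := by
  rw [show (1 : F[X]) = C 1 from C_1.symm, reverse_C, coeff_C]

theorem coeff_zero_reverse_of_monic {f : F[X]} (hf : f.Monic) : f.reverse.coeff 0 = 1 := by
  rw [coeff_zero_reverse]; exact hf

theorem nextToLeadingCoeff_eq_coeff_reverse {f : F[X]} {j : ℕ} :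
    nextToLeadingCoeff f j = f.reverse.coeff j := by
  rw [nextToLeadingCoeff]
  split_ifs with h
  · rw [coeff_reverse_of_le h]
  · rw [coeff_reverse, revAt_eq_self_of_lt (by omega), coeff_eq_zero_of_natDegree_lt (by omega)]

theorem levelQuot_mk_eq_one {ℓ : ℕ} {f : monics F} :
    ((f : LevelQuot F ℓ) = 1) ↔ ∀ i : Fin ℓ, nextToLeadingCoeff (f : F[X]) (i + 1) = 0 := by
  rw [← Con.coe_one, levelQuot_mk_eq]
  constructor
  · intro h i
    rw [nextToLeadingCoeff_eq_coeff_reverse, h (i + 1) (by omega), Submonoid.coe_one,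
      coeff_reverse_one, if_neg (by omega)]
  · intro h j hj
    rw [Submonoid.coe_one, coeff_reverse_one]
    split_ifs with h0
    · rw [h0]; exact coeff_zero_reverse_of_monic f.2
    · have := h ⟨j - 1, by omega⟩
      rwa [nextToLeadingCoeff_eq_coeff_reverse, show j - 1 + 1 = j by omega] at this

open Classical in
/-- The function on polynomials given by a character of `LevelQuot F ℓ`, with value `0` at
polynomials that are not monic. -/
def evalChar {ℓ : ℕ} (χ : LevelQuot F ℓ →* ℂˣ) (f : F[X]) : ℂ :=
  if h : f.Monic then (χ ((⟨f, h⟩ : monics F) : LevelQuot F ℓ) : ℂ) else 0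

theorem evalChar_of_monic {ℓ : ℕ} (χ : LevelQuot F ℓ →* ℂˣ) {f : F[X]} (h : f.Monic) :
    evalChar χ f = (χ ((⟨f, h⟩ : monics F) : LevelQuot F ℓ) : ℂ) := dif_pos h

theorem isLevelChar_evalChar {ℓ : ℕ} (χ : LevelQuot F ℓ →* ℂˣ) : IsLevelChar ℓ (evalChar χ) where
  map_one := by
    rw [evalChar_of_monic χ monic_one]
    change ((χ 1 : ℂˣ) : ℂ) = 1
    simp
  map_mul f g hf hg := by
    rw [evalChar_of_monic χ hf, evalChar_of_monic χ hg, evalChar_of_monic χ (hf.mul hg),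
      ← Units.val_mul, ← map_mul]
    rfl
  congr f g hf hg h := by
    rw [evalChar_of_monic χ hf, evalChar_of_monic χ hg]
    congr 2
    exact levelQuot_mk_eq.2 h

theorem exists_evalChar_ne_one {ℓ : ℕ} {χ : LevelQuot F ℓ →* ℂˣ} (hχ : χ ≠ 1) :
    ∃ g : F[X], g.Monic ∧ evalChar χ g ≠ 1 := by
  by_contra! h
  apply hχ
  refine MonoidHom.ext fun x => ?_
  induction x using Con.induction_on with
  | H f =>
    have := h f f.2
    rw [evalChar_of_monic χ f.2] at this
    exact Units.ext this

/-- The reverse of a monic polynomial is `1 + X * u`; its `p ^ k`-th power is `1 + X ^ (p ^ k) * u ^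
(p ^ k)`, trivial up to degree `ℓ`. This also makes the quotient monoid a group. -/
theorem pow_eq_one_of_lt (p : ℕ) [Fact p.Prime] [CharP F p] {ℓ k : ℕ} (hk : ℓ < p ^ k)
    (x : LevelQuot F ℓ) : x ^ p ^ k = 1 := by
  induction x using Con.induction_on with
  | H f =>
    rw [show (f : LevelQuot F ℓ) ^ p ^ k = ((f ^ p ^ k : monics F) : LevelQuot F ℓ) from
      (map_pow (levelCon F ℓ).mk' f _).symm, ← Con.coe_one, levelQuot_mk_eq]
    intro j hj
    have hpow : ∀ n : ℕ, ((f ^ n : monics F) : F[X]).reverse = (f : F[X]).reverse ^ n := by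
      intro n
      induction n with
      | zero => rw [pow_zero, pow_zero, Submonoid.coe_one, ← C_1, reverse_C]
      | succ n ih => rw [pow_succ, Submonoid.coe_mul, reverse_mul_of_domain, ih, pow_succ]
    have hcp : CharP F[X] p := inferInstance
    rw [hpow, Submonoid.coe_one, coeff_reverse_one]
    conv_lhs => rw [← divX_mul_X_add (f : F[X]).reverse, coeff_zero_reverse_of_monic f.2]
    rw [add_pow_char_pow, mul_pow, C_1, one_pow, coeff_add, coeff_mul_X_pow',
      if_neg (by omega), coeff_one, zero_add]

variable [Fintype F]

instance (ℓ : ℕ) : CommGroup (LevelQuot F ℓ) :=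
  commGroupOfIsUnit (M := LevelQuot F ℓ) fun x => by
    obtain ⟨p, hp⟩ := CharP.exists F
    have hpr : Fact p.Prime := ⟨CharP.char_is_prime F p⟩
    exact IsUnit.of_pow_eq_one (pow_eq_one_of_lt p (Nat.lt_pow_self hpr.out.one_lt) x)
      (pow_pos hpr.out.pos ℓ).ne'

instance (ℓ : ℕ) : Finite (LevelQuot F ℓ) := by
  refine Finite.of_injective (β := Fin (ℓ + 1) → F)
    (fun x => Con.liftOn x (fun f => fun j : Fin (ℓ + 1) => (f : F[X]).reverse.coeff j) ?_) ?_
  · intro f g h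
    funext j
    exact h j (by omega)
  · intro x y
    induction x, y using Con.induction_on₂ with
    | _ f g =>
      intro h
      rw [levelQuot_mk_eq]
      intro j hj
      exact congrFun h ⟨j, by omega⟩

theorem card_monicOfDegree (n : ℕ) : (monicOfDegree F n).card = Fintype.card F ^ n := by
  have e : {f // f ∈ monicOfDegree F n} ≃ (Fin n → F) :=
    (Equiv.subtypeEquivRight fun f => mem_monicOfDegree).trans
      ((monicEquivDegreeLT n).trans (degreeLTEquiv F n).toEquiv)
  rw [← Fintype.card_coe, Fintype.card_congr e]
  simp

/-- The induced map on the quotient takes values in units because its source is a group. -/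
theorem exists_evalChar_eq {ℓ : ℕ} {h : F[X] → ℂ} (hh : IsLevelChar ℓ h) :
    ∃ χ : LevelQuot F ℓ →* ℂˣ, ∀ f : F[X], f.Monic → evalChar χ f = h f := by
  let φ : monics F →* ℂ :=
    { toFun := fun f => h f
      map_one' := hh.map_one
      map_mul' := fun f g => hh.map_mul f g f.2 g.2 }
  let ψ : LevelQuot F ℓ →* ℂ := (levelCon F ℓ).lift φ (by
    intro f g hfg
    exact hh.congr f g f.2 g.2 hfg)
  refine ⟨ψ.toHomUnits, ?_⟩
  intro f hf
  rw [evalChar_of_monic _ hf, MonoidHom.coe_toHomUnits]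
  rfl

instance (ℓ : ℕ) : Finite (LevelQuot F ℓ →* ℂˣ) :=
  Finite.of_equiv _
    (CommGroup.monoidHom_mulEquiv_of_hasEnoughRootsOfUnity (LevelQuot F ℓ) ℂ).some.symm.toEquiv

instance (ℓ : ℕ) : Fintype (LevelQuot F ℓ →* ℂˣ) := Fintype.ofFinite _

open Classical in
theorem sum_char_eq {ℓ : ℕ} (x : LevelQuot F ℓ) :
    ∑ χ : LevelQuot F ℓ →* ℂˣ, (χ x : ℂ) =
      if x = 1 then (Fintype.card (LevelQuot F ℓ →* ℂˣ) : ℂ) else 0 := by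
  split_ifs with h
  · simp [h]
  · obtain ⟨φ, hφ⟩ := CommGroup.exists_apply_ne_one_of_hasEnoughRootsOfUnity (LevelQuot F ℓ) ℂ h
    have h1 : ∑ χ : LevelQuot F ℓ →* ℂˣ, (φ x : ℂ) * (χ x : ℂ) =
        ∑ χ : LevelQuot F ℓ →* ℂˣ, (χ x : ℂ) :=
      Fintype.sum_equiv (Equiv.mulLeft φ) _ _ (fun χ => by simp)
    rw [← Finset.mul_sum] at h1
    have h2 : ((φ x : ℂ) - 1) * ∑ χ : LevelQuot F ℓ →* ℂˣ, (χ x : ℂ) = 0 := by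
      rw [sub_mul, h1]; ring
    refine (mul_eq_zero.1 h2).resolve_left (sub_ne_zero.2 ?_)
    exact fun e => hφ (Units.ext e)

/-- Orthogonality of characters, summed over the monic polynomials of degree `n`. -/
theorem sum_char_sum_monicOfDegree {ℓ n : ℕ} (g : F[X] → ℂ) :
    ∑ χ : LevelQuot F ℓ →* ℂˣ, ∑ f ∈ monicOfDegree F n, g f * evalChar χ f =
      (Fintype.card (LevelQuot F ℓ →* ℂˣ) : ℂ) *
        ∑ f ∈ (monicWithCoeffs_finite F n (fun _ : Fin ℓ => (0 : F))).toFinset, g f := by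
  classical
  rw [Finset.sum_comm, Finset.mul_sum]
  symm
  refine Finset.sum_subset_zero_on_sdiff ?_ ?_ ?_
  · intro f hf
    simp only [Set.Finite.mem_toFinset, monicWithCoeffs, Set.mem_ofPred_eq] at hf
    exact mem_monicOfDegree.2 ⟨hf.1, hf.2.1⟩
  · intro f hf
    rw [Finset.mem_sdiff] at hf
    obtain ⟨hf, hnot⟩ := hf
    obtain ⟨hm, hd⟩ := mem_monicOfDegree.1 hf
    rw [← Finset.mul_sum]
    simp only [evalChar_of_monic _ hm]
    rw [sum_char_eq, if_neg, mul_zero]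
    rw [levelQuot_mk_eq_one]
    intro h
    apply hnot
    simpa [monicWithCoeffs] using ⟨hm, hd, h⟩
  · intro f hf
    simp only [Set.Finite.mem_toFinset, monicWithCoeffs, Set.mem_ofPred_eq] at hf
    obtain ⟨hm, hd, hc⟩ := hf
    rw [← Finset.mul_sum]
    simp only [evalChar_of_monic _ hm]
    rw [sum_char_eq, if_pos (levelQuot_mk_eq_one.2 hc), mul_comm]

theorem monicWithCoeffs_zero_self (ℓ : ℕ) :
    (monicWithCoeffs_finite F ℓ (fun _ : Fin ℓ => (0 : F))).toFinset = {X ^ ℓ} := by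
  ext f
  simp only [Set.Finite.mem_toFinset, monicWithCoeffs, Set.mem_ofPred_eq, Finset.mem_singleton]
  constructor
  · rintro ⟨hm, hd, hc⟩
    ext i
    rw [coeff_X_pow]
    split_ifs with h
    · rw [h, ← hd]; exact hm
    · rcases lt_or_gt_of_ne h with h | h
      · have := hc ⟨ℓ - i - 1, by omega⟩
        rw [nextToLeadingCoeff, if_pos (by simp; omega)] at this
        convert this using 2
        simp; omega
      · exact coeff_eq_zero_of_natDegree_lt (by omega)
  · rintro rfl
    refine ⟨monic_X_pow ℓ, natDegree_X_pow ℓ, ?_⟩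
    intro i
    rw [nextToLeadingCoeff, natDegree_X_pow, if_pos (by omega), coeff_X_pow, if_neg (by omega)]

/-- Orthogonality in degree `n = ℓ`: only `X ^ ℓ` has all `ℓ` coefficients zero, and only the
trivial character has a nonzero sum, namely `q ^ ℓ`. -/
theorem card_levelChars (ℓ : ℕ) :
    Fintype.card (LevelQuot F ℓ →* ℂˣ) = Fintype.card F ^ ℓ := by
  have h1 := sum_char_sum_monicOfDegree (F := F) (ℓ := ℓ) (n := ℓ) (fun _ => 1)
  rw [monicWithCoeffs_zero_self, Finset.sum_singleton, mul_one,
    Fintype.sum_eq_single (1 : LevelQuot F ℓ →* ℂˣ)] at h1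
  · have h2 : ∀ f ∈ monicOfDegree F ℓ, (1 : ℂ) * evalChar (1 : LevelQuot F ℓ →* ℂˣ) f = 1 := by
      intro f hf
      rw [evalChar_of_monic _ (mem_monicOfDegree.1 hf).1]
      simp
    rw [Finset.sum_congr rfl h2, Finset.sum_const, card_monicOfDegree, nsmul_one] at h1
    exact_mod_cast h1.symm
  · intro χ hχ
    obtain ⟨g, hg, hne⟩ := exists_evalChar_ne_one hχ
    simpa [monicSum] using monicSum_eq_zero (isLevelChar_evalChar χ) hg hne le_rfl

theorem mangoldtSum_congr {h h' : F[X] → ℂ} (e : ∀ f : F[X], f.Monic → h f = h' f) (n : ℕ) :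
    mangoldtSum h n = mangoldtSum h' n :=
  Finset.sum_congr rfl fun f hf => by rw [e f (mem_monicOfDegree.1 hf).1]

/-- The explicit formula for `ψ_q(n, 0, …, 0)`: a multiset of zeros that contains the zeros
attached to every nontrivial character of level `ℓ`. -/
theorem exists_multiset_psi (F : Type*) [Field F] [Fintype F] (ℓ : ℕ) : ∃ S : Multiset ℂ, 0 ∉ S ∧
    (∀ n, 1 ≤ n → (Fintype.card F : ℂ) ^ ℓ * psi F n (fun _ : Fin ℓ => (0 : F)) =
      mangoldtSum (fun _ : F[X] => 1) n - (S.map fun γ => γ ^ n).sum) ∧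
    ∀ h : F[X] → ℂ, IsLevelChar ℓ h → (∃ g : F[X], g.Monic ∧ h g ≠ 1) →
      ∃ s ≤ S, ∀ n, 1 ≤ n → mangoldtSum h n = -(s.map fun γ => γ ^ n).sum := by
  classical
  have hex : ∀ χ : LevelQuot F ℓ →* ℂˣ, ∃ s : Multiset ℂ, 0 ∉ s ∧
      (χ ≠ 1 → ∀ n, 1 ≤ n → mangoldtSum (evalChar χ) n = -(s.map fun γ => γ ^ n).sum) := by
    intro χ
    by_cases hχ : χ = 1
    · exact ⟨0, by simp, fun h => absurd hχ h⟩
    · obtain ⟨g, hg, hne⟩ := exists_evalChar_ne_one hχ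
      obtain ⟨s, hs, hsn⟩ := exists_mangoldtSum_eq (isLevelChar_evalChar χ) hg hne
      exact ⟨s, hs, fun _ => hsn⟩
  choose s hs0 hs using hex
  -- Keeping multiplicities makes each character's inverse zeros a submultiset.
  refine ⟨∑ χ ∈ Finset.univ.erase (1 : LevelQuot F ℓ →* ℂˣ), s χ, ?_, ?_, ?_⟩
  · rw [Multiset.mem_sum]
    rintro ⟨χ, -, h⟩
    exact hs0 χ h
  · intro n hn
    have h1 := sum_char_sum_monicOfDegree (F := F) (ℓ := ℓ) (n := n) vonMangoldt
    rw [card_levelChars] at h1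
    rw [psi, ← Nat.cast_pow, ← h1, ← Finset.add_sum_erase _ _ (Finset.mem_univ 1), sub_eq_add_neg]
    congr 1
    · exact mangoldtSum_congr (fun f hf => by rw [evalChar_of_monic _ hf]; simp) n
    · have hmap : ∀ T : Finset (LevelQuot F ℓ →* ℂˣ),
          ((∑ χ ∈ T, s χ).map fun γ => γ ^ n).sum = ∑ χ ∈ T, ((s χ).map fun γ => γ ^ n).sum := by
        intro T
        induction T using Finset.induction with
        | empty => simp
        | insert a T ha ih => rw [Finset.sum_insert ha, Finset.sum_insert ha]; simp [ih]
      rw [hmap, ← Finset.sum_neg_distrib]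
      refine Finset.sum_congr rfl ?_
      intro χ hχ
      exact hs χ (Finset.ne_of_mem_erase hχ) n hn
  · rintro h hh ⟨g, hg, hne⟩
    obtain ⟨χ, hχ⟩ := exists_evalChar_eq hh
    have hχ1 : χ ≠ 1 := by
      rintro rfl
      apply hne
      rw [← hχ g hg, evalChar_of_monic _ hg]
      simp
    refine ⟨s χ, ?_, ?_⟩
    · exact Finset.single_le_sum (f := s) (fun _ _ => zero_le)
        (Finset.mem_erase.2 ⟨hχ1, Finset.mem_univ χ⟩)
    · intro n hn
      rw [← mangoldtSum_congr hχ n]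
      exact hs χ hχ1 n hn

end Duality

/-! ### The norm of polynomials along an extension of finite fields. -/

section NormPoly

theorem reverse_map_of_field {F K : Type*} [Field F] [Field K] (φ : F →+* K) (f : F[X]) :
    (f.map φ).reverse = f.reverse.map φ := by
  ext j
  rw [coeff_reverse, coeff_map, coeff_map, coeff_reverse, natDegree_map]

variable (F : Type*) [Field F] [Fintype F] (K : Type*) [Field K] [Algebra F K]

/-- The ring endomorphism `x ↦ x ^ (q ^ i)` of an extension of the field `F` with `q` elements. -/
def frobPow (i : ℕ) : K →+* K := ((FiniteField.frobeniusAlgHom F K) ^ i : K →ₐ[F] K)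

variable {K}

theorem frobPow_apply (i : ℕ) (x : K) : frobPow F K i x = x ^ Fintype.card F ^ i := by
  change ((FiniteField.frobeniusAlgHom F K) ^ i) x = _
  rw [AlgHom.coe_pow, FiniteField.coe_frobeniusAlgHom, pow_iterate]

variable (K)

theorem frobPow_comp_frobPow (i j : ℕ) :
    (frobPow F K i).comp (frobPow F K j) = frobPow F K (i + j) := by
  ext x
  rw [RingHom.comp_apply, frobPow_apply, frobPow_apply, frobPow_apply, ← pow_mul, ← pow_add,
    add_comm]

theorem frobPow_zero : frobPow F K 0 = RingHom.id K := by
  ext x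
  simp [frobPow_apply]

variable [Fintype K]

theorem frobPow_finrank : frobPow F K (Module.finrank F K) = RingHom.id K := by
  ext x
  rw [frobPow_apply, ← Module.card_eq_pow_finrank, FiniteField.pow_card, RingHom.id_apply]

variable {K} in
theorem mem_range_algebraMap_of_pow_card_eq {x : K} (hx : x ^ Fintype.card F = x) :
    x ∈ Set.range (algebraMap F K) := by
  have h : x ∈ (⊥ : IntermediateField F K) := by
    rw [IsGalois.mem_bot_iff_fixed]
    intro f
    obtain ⟨i, rfl⟩ := (FiniteField.bijective_frobeniusAlgEquivOfAlgebraic_pow F K).2 f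
    rw [AlgEquiv.coe_pow]
    exact Function.iterate_fixed hx _
  exact IntermediateField.mem_bot.1 h

/-- Frobenius permutes the conjugates cyclically, so it fixes the coefficients of their product,
which therefore lie in `F`. -/
theorem exists_normPoly (g : K[X]) : ∃ f : F[X], f.map (algebraMap F K) =
    ∏ i ∈ Finset.range (Module.finrank F K), g.map (frobPow F K i) := by
  set P := ∏ i ∈ Finset.range (Module.finrank F K), g.map (frobPow F K i) with hP
  have hfix : P.map (frobPow F K 1) = P := by
    have h1 : P.map (frobPow F K 1) =
        ∏ i ∈ Finset.range (Module.finrank F K), g.map (frobPow F K (i + 1)) := by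
      rw [hP, Polynomial.map_prod]
      refine Finset.prod_congr rfl fun i _ => ?_
      rw [Polynomial.map_map, frobPow_comp_frobPow, add_comm]
    obtain ⟨n, hn⟩ : ∃ n, Module.finrank F K = n + 1 :=
      ⟨Module.finrank F K - 1, (Nat.succ_pred_eq_of_pos Module.finrank_pos).symm⟩
    have hlast := frobPow_finrank F K
    rw [h1, hP, hn, Finset.prod_range_succ, Finset.prod_range_succ', ← hn, hlast, frobPow_zero]
  rw [← mem_lifts, lifts_iff_coeff_lifts]
  intro n
  apply mem_range_algebraMap_of_pow_card_eq
  conv_rhs => rw [← hfix, coeff_map, frobPow_apply, pow_one]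

variable {K}

/-- The norm of a polynomial from `K[X]` to `F[X]`, the product of its conjugates. -/
def normPoly (g : K[X]) : F[X] := (exists_normPoly F K g).choose

theorem map_normPoly (g : K[X]) : (normPoly F g).map (algebraMap F K) =
    ∏ i ∈ Finset.range (Module.finrank F K), g.map (frobPow F K i) :=
  (exists_normPoly F K g).choose_spec

theorem normPoly_one : normPoly F (1 : K[X]) = 1 := by
  apply map_injective _ (algebraMap F K).injective
  simp [map_normPoly]

theorem normPoly_mul (f g : K[X]) : normPoly F (f * g) = normPoly F f * normPoly F g := by
  apply map_injective _ (algebraMap F K).injective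
  simp [map_normPoly, Finset.prod_mul_distrib]

theorem monic_normPoly {g : K[X]} (hg : g.Monic) : (normPoly F g).Monic := by
  rw [← monic_map_iff (f := algebraMap F K), map_normPoly]
  exact monic_prod_of_monic _ _ fun i _ => hg.map _

theorem natDegree_normPoly {g : K[X]} (hg : g.Monic) :
    (normPoly F g).natDegree = Module.finrank F K * g.natDegree := by
  rw [← natDegree_map (algebraMap F K), map_normPoly,
    natDegree_prod_of_monic _ _ fun i _ => hg.map _]
  simp

theorem coeff_reverse_normPoly_congr {ℓ : ℕ} {f g : K[X]}
    (h : ∀ j ≤ ℓ, f.reverse.coeff j = g.reverse.coeff j) :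
    ∀ j ≤ ℓ, (normPoly F f).reverse.coeff j = (normPoly F g).reverse.coeff j := by
  have key : ∀ m : ℕ, ∀ j ≤ ℓ,
      (∏ i ∈ Finset.range m, f.map (frobPow F K i)).reverse.coeff j =
        (∏ i ∈ Finset.range m, g.map (frobPow F K i)).reverse.coeff j := by
    intro m
    induction m with
    | zero => simp
    | succ m ih =>
      rw [Finset.prod_range_succ, Finset.prod_range_succ]
      refine coeff_reverse_mul_congr ih ?_
      intro j hj
      rw [reverse_map_of_field, reverse_map_of_field, coeff_map, coeff_map, h j hj]
  intro j hj
  apply (algebraMap F K).injective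
  rw [← coeff_map, ← coeff_map, ← reverse_map_of_field, ← reverse_map_of_field, map_normPoly,
    map_normPoly, key _ j hj]

theorem IsLevelChar.comp_normPoly {ℓ : ℕ} {h : F[X] → ℂ} (hh : IsLevelChar ℓ h) :
    IsLevelChar ℓ fun g : K[X] => h (normPoly F g) where
  map_one := by rw [normPoly_one, hh.map_one]
  map_mul f g hf hg := by
    rw [normPoly_mul, hh.map_mul _ _ (monic_normPoly F hf) (monic_normPoly F hg)]
  congr f g hf hg e :=
    hh.congr _ _ (monic_normPoly F hf) (monic_normPoly F hg) (coeff_reverse_normPoly_congr F e)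

theorem prod_range_mul {M : Type*} [CommMonoid M] (f : ℕ → M) (m n : ℕ) :
    ∏ k ∈ Finset.range (m * n), f k =
      ∏ i ∈ Finset.range m, ∏ j ∈ Finset.range n, f (i + m * j) := by
  rw [Finset.prod_comm]
  induction n with
  | zero => simp
  | succ n ih =>
    rw [Nat.mul_succ, Finset.prod_range_add, ih, Finset.prod_range_succ]
    congr 1
    exact Finset.prod_congr rfl fun i _ => by rw [add_comm]

/-- Transitivity of the norm in a tower of finite fields. -/
theorem normPoly_normPoly (E : Type*) [Field E] [Fintype E] [Algebra E F] [Algebra E K]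
    [IsScalarTower E F K] (g : K[X]) : normPoly E (normPoly F g) = normPoly E g := by
  apply map_injective _ (algebraMap E K).injective
  rw [map_normPoly, IsScalarTower.algebraMap_eq E F K, ← Polynomial.map_map, map_normPoly,
    Polynomial.map_prod, ← Module.finrank_mul_finrank E F K, prod_range_mul]
  refine Finset.prod_congr rfl fun i _ => ?_
  have hcomm : (algebraMap F K).comp (frobPow E F i) = (frobPow E K i).comp (algebraMap F K) := by
    ext x
    simp [frobPow_apply]
  rw [Polynomial.map_map, hcomm, ← Polynomial.map_map, map_normPoly, Polynomial.map_prod]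
  refine Finset.prod_congr rfl fun j _ => ?_
  rw [Polynomial.map_map]
  congr 1
  ext x
  rw [RingHom.comp_apply, frobPow_apply, frobPow_apply, frobPow_apply, ← pow_mul,
    Module.card_eq_pow_finrank (K := E) (V := F), ← pow_mul, ← pow_add, add_comm]

/-- Each conjugate of `α` is a root of its minimal polynomial, so the norm divides a power of that
irreducible polynomial; the degree excludes exponent 0. -/
theorem exists_normPoly_X_sub_C_eq_pow (α : K) :
    ∃ k, 1 ≤ k ∧ normPoly F (X - C α) = minpoly F α ^ k := by
  have hint : IsIntegral F α := Algebra.IsIntegral.isIntegral α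
  have hdvd : normPoly F (X - C α) ∣ minpoly F α ^ Module.finrank F K := by
    rw [← map_dvd_map' (algebraMap F K), map_normPoly, Polynomial.map_pow]
    have : ∀ i ∈ Finset.range (Module.finrank F K),
        (X - C α).map (frobPow F K i) ∣ (minpoly F α).map (algebraMap F K) := by
      intro i _
      rw [Polynomial.map_sub, map_X, map_C, dvd_iff_isRoot, IsRoot, eval_map_algebraMap]
      change aeval (((FiniteField.frobeniusAlgHom F K) ^ i : K →ₐ[F] K) α) (minpoly F α) = 0
      rw [aeval_algHom_apply, minpoly.aeval, map_zero]
    refine (Finset.prod_dvd_prod_of_dvd _ _ this).trans ?_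
    simp
  obtain ⟨k, -, hk⟩ := (dvd_prime_pow (minpoly.irreducible hint).prime _).1 hdvd
  have he : normPoly F (X - C α) = minpoly F α ^ k :=
    eq_of_monic_of_associated (monic_normPoly F (monic_X_sub_C α)) ((minpoly.monic hint).pow k) hk
  refine ⟨k, ?_, he⟩
  by_contra h0
  have hd := natDegree_normPoly F (monic_X_sub_C α)
  rw [he, show k = 0 by omega, natDegree_X_sub_C] at hd
  have : 0 < Module.finrank F K := Module.finrank_pos
  simp at hd
  omega

-- The elements with norm polynomial `P ^ k` are the roots of `P` in `K`. There are `deg P` of them,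
-- as `P` is separable and splits because its degree divides `[K : F]`.
open Classical in
theorem card_filter_normPoly_eq {f : F[X]} (hf : f ∈ monicOfDegree F (Module.finrank F K)) :
    ((Finset.univ.filter fun α : K => normPoly F (X - C α) = f).card : ℂ) = vonMangoldt f := by
  obtain ⟨hm, hd⟩ := mem_monicOfDegree.1 hf
  by_cases hex : ∃ P : F[X], P.Monic ∧ Irreducible P ∧ ∃ k : ℕ, 1 ≤ k ∧ f = P ^ k
  · obtain ⟨P, hP, hPi, k, hk, rfl⟩ := hex
    rw [vonMangoldt_pow hP hPi hk]
    have hset : (Finset.univ.filter fun α : K => normPoly F (X - C α) = P ^ k) =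
        (P.rootSet K).toFinset := by
      ext α
      have hint : IsIntegral F α := Algebra.IsIntegral.isIntegral α
      obtain ⟨j, hj, e⟩ := exists_normPoly_X_sub_C_eq_pow F α
      simp only [Finset.mem_filter, Finset.mem_univ, true_and, Set.mem_toFinset,
        mem_rootSet_of_ne hP.ne_zero]
      rw [e]
      constructor
      · intro h
        rw [← eq_of_monic_pow_eq_pow (minpoly.monic hint) (minpoly.irreducible hint) hP hPi hj h,
          minpoly.aeval]
      · intro h
        have hPm := minpoly.eq_of_irreducible_of_monic hPi h hP
        rw [← hPm] at e ⊢
        have hdd := natDegree_normPoly F (monic_X_sub_C α)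
        rw [e, natDegree_X_sub_C, mul_one, ← hd, natDegree_pow, natDegree_pow] at hdd
        rw [Nat.eq_of_mul_eq_mul_right hPi.natDegree_pos hdd]
    have hsplit : (P.map (algebraMap F K)).Splits := by
      have hdvd : P.natDegree ∣ Module.finrank F K := by
        rw [← hd, natDegree_pow]
        exact dvd_mul_left _ _
      rw [hPi.natDegree_dvd_iff_dvd_X_pow_card_pow_sub_X, Nat.card_eq_fintype_card,
        ← Module.card_eq_pow_finrank] at hdvd
      refine Splits.of_dvd (FiniteField.isSplittingField_sub K F).splits ?_
        (Polynomial.map_dvd (algebraMap F K) hdvd)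
      exact (Polynomial.map_ne_zero_iff (algebraMap F K).injective).2
        (FiniteField.X_pow_card_sub_X_ne_zero F Fintype.one_lt_card)
    rw [hset, Set.toFinset_card,
      card_rootSet_eq_natDegree (PerfectField.separable_of_irreducible hPi) hsplit]
  · rw [vonMangoldt_eq_zero hex, Nat.cast_eq_zero, Finset.card_eq_zero, Finset.filter_eq_empty_iff]
    intro α _ h
    obtain ⟨k, hk, e⟩ := exists_normPoly_X_sub_C_eq_pow F α
    have hint : IsIntegral F α := Algebra.IsIntegral.isIntegral α
    exact hex ⟨_, minpoly.monic hint, minpoly.irreducible hint, k, hk, h ▸ e⟩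

/-- The sum of `Λ h` over the monic polynomials of degree `[K : F]` is the sum of `h` over the
characteristic polynomials of the elements of `K`. -/
theorem mangoldtSum_finrank (h : F[X] → ℂ) :
    mangoldtSum h (Module.finrank F K) = ∑ α : K, h (normPoly F (X - C α)) := by
  classical
  rw [mangoldtSum, ← Finset.sum_fiberwise_of_maps_to
    (s := (Finset.univ : Finset K)) (t := monicOfDegree F (Module.finrank F K))
    (g := fun α : K => normPoly F (X - C α))]
  · refine Finset.sum_congr rfl fun f hf => ?_
    rw [← card_filter_normPoly_eq F (K := K) hf, ← nsmul_eq_mul, ← Finset.sum_const]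
    refine Finset.sum_congr rfl fun α hα => ?_
    rw [(Finset.mem_filter.1 hα).2]
  · intro α _
    exact mem_monicOfDegree.2 ⟨monic_normPoly F (monic_X_sub_C α), by
      rw [natDegree_normPoly F (monic_X_sub_C α), natDegree_X_sub_C, mul_one]⟩

end NormPoly

/-! ### Base change from the prime field. -/

section BaseChange

theorem mangoldtSum_const_one (F : Type*) [Field F] [Fintype F] {n : ℕ} (hn : 1 ≤ n) :
    mangoldtSum (fun _ : F[X] => 1) n = (Fintype.card F : ℂ) ^ n := by
  obtain ⟨p, hp⟩ := CharP.exists F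
  have : Fact p.Prime := ⟨CharP.char_is_prime F p⟩
  have : NeZero n := ⟨by omega⟩
  have : Fintype (FiniteField.Extension F p n) := Fintype.ofFinite _
  have h := mangoldtSum_finrank F (K := FiniteField.Extension F p n) fun _ => 1
  rw [FiniteField.finrank_extension] at h
  rw [h, Finset.sum_const, Finset.card_univ, Module.card_eq_pow_finrank (K := F),
    FiniteField.finrank_extension]
  simp

/-- Base change from the prime field. -/
theorem mangoldtSum_comp_normPoly (p : ℕ) [Fact p.Prime] (F : Type*) [Field F] [Fintype F]
    [CharP F p] [Algebra (ZMod p) F] (h : (ZMod p)[X] → ℂ) {n : ℕ} (hn : 1 ≤ n) :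
    mangoldtSum (fun g : F[X] => h (normPoly (ZMod p) g)) n =
      mangoldtSum h (Module.finrank (ZMod p) F * n) := by
  have : NeZero n := ⟨by omega⟩
  have : Fintype (FiniteField.Extension F p n) := Fintype.ofFinite _
  have h1 := mangoldtSum_finrank F (K := FiniteField.Extension F p n)
    fun g : F[X] => h (normPoly (ZMod p) g)
  have h2 := mangoldtSum_finrank (ZMod p) (K := FiniteField.Extension F p n) h
  rw [FiniteField.finrank_extension] at h1
  rw [FiniteField.finrank_zmod_extension] at h2
  rw [h1, h2]
  refine Finset.sum_congr rfl fun α _ => ?_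
  rw [normPoly_normPoly]

end BaseChange

/-! ### Divisibility by `p` in cyclotomic rings. -/

section Cyclotomic

theorem exists_aeval_eq_of_isIntegral {n : ℕ} [NeZero n] {ζ : ℂ} (hζ : IsPrimitiveRoot ζ n)
    {x : ℂ} (hx : IsIntegral ℤ x) (hmem : x ∈ IntermediateField.adjoin ℚ {ζ}) :
    ∃ B : ℤ[X], aeval ζ B = x := by
  set K := IntermediateField.adjoin ℚ ({ζ} : Set ℂ) with hK
  have hcyc : IsCyclotomicExtension {n} ℚ K := by
    change IsCyclotomicExtension {n} ℚ K.toSubalgebra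
    rw [hK, IntermediateField.adjoin_simple_toSubalgebra_of_isAlgebraic
      (hζ.isIntegral (NeZero.pos n)).tower_top.isAlgebraic]
    exact hζ.adjoin_isCyclotomicExtension ℚ
  let z : K := ⟨ζ, IntermediateField.mem_adjoin_simple_self ℚ ζ⟩
  have hz : IsPrimitiveRoot z n := IsPrimitiveRoot.coe_submonoidClass_iff.mp hζ
  let y : K := ⟨x, hmem⟩
  have hy : IsIntegral ℤ y := (isIntegral_algebraMap_iff (algebraMap K ℂ).injective).1 hx
  obtain ⟨w, hw⟩ :=
    (IsCyclotomicExtension.Rat.isIntegralClosure_adjoin_singleton hz).isIntegral_iff.1 hy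
  have hwm : y ∈ Algebra.adjoin ℤ ({z} : Set K) := hw ▸ w.2
  rw [Algebra.adjoin_singleton_eq_range_aeval] at hwm
  obtain ⟨B, hB⟩ := hwm
  refine ⟨B, ?_⟩
  have h := congrArg (algebraMap K ℂ) hB
  change algebraMap K ℂ (aeval z B) = x at h
  rw [← aeval_algebraMap_apply] at h
  exact h

/-- The integer `η` lies in `ℚ(ζ)`, hence equals `B(ζ)` with `B` integral. The cyclotomic polynomial
then divides `A ^ 2 - p * B`, and modulo `p` it is a power of `X - 1`. -/
theorem sub_one_pow_dvd_of_sq_eq {p k : ℕ} [Fact p.Prime] (hk : 0 < k) {ζ : ℂ}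
    (hζ : IsPrimitiveRoot ζ (p ^ k)) (A : ℤ[X]) {η : ℂ} (hη : IsIntegral ℤ η)
    (h : aeval ζ A ^ 2 = p * η) :
    (X - 1) ^ (p ^ k - p ^ (k - 1)) ∣ (A.map (Int.castRingHom (ZMod p))) ^ 2 := by
  have hp : p.Prime := Fact.out
  have hne : NeZero (p ^ k) := ⟨(pow_pos hp.pos k).ne'⟩
  have hmem : η ∈ IntermediateField.adjoin ℚ ({ζ} : Set ℂ) := by
    have hp0 : (p : ℂ) ≠ 0 := Nat.cast_ne_zero.2 hp.ne_zero
    have e : η = aeval ζ A ^ 2 / p := by rw [h]; field_simp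
    rw [e]
    refine div_mem (pow_mem ?_ 2) (natCast_mem _ p)
    rw [aeval_eq_sum_range]
    refine sum_mem fun i _ => ?_
    exact zsmul_mem (pow_mem (IntermediateField.mem_adjoin_simple_self ℚ ζ) i) _
  obtain ⟨B, hB⟩ := exists_aeval_eq_of_isIntegral hζ hη hmem
  have hdvd : cyclotomic (p ^ k) ℤ ∣ A ^ 2 - C (p : ℤ) * B := by
    rw [cyclotomic_eq_minpoly hζ (pow_pos hp.pos k)]
    refine minpoly.isIntegrallyClosed_dvd (hζ.isIntegral (pow_pos hp.pos k)) ?_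
    rw [map_sub, map_pow, map_mul, aeval_C, hB, h]
    simp
  have h2 := Polynomial.map_dvd (Int.castRingHom (ZMod p)) hdvd
  rw [map_cyclotomic_int, Polynomial.map_sub, Polynomial.map_mul, map_C, Polynomial.map_pow] at h2
  have h3 := cyclotomic_mul_prime_pow_eq (ZMod p) (p := p) (m := 1)
    (by rw [Nat.dvd_one]; exact hp.one_lt.ne') hk
  rw [mul_one, cyclotomic_one] at h3
  rw [h3] at h2
  simpa using h2

/-- The operator `X * d/dX` multiplies `X ^ e` by `e` and lowers the order of vanishing at 1 by at
most one; apply it `j` times and evaluate at 1. -/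
theorem sum_pow_eq_zero_of_dvd {R ι : Type*} [CommRing R] [Fintype ι] (e : ι → ℕ) {m j : ℕ}
    (hj : j < m) (h : (X - 1 : R[X]) ^ m ∣ ∑ c, X ^ e c) : ∑ c, (e c : R) ^ j = 0 := by
  have key : ∀ i ≤ m, (X - 1 : R[X]) ^ (m - i) ∣ ∑ c, C ((e c : R) ^ i) * X ^ e c := by
    intro i
    induction i with
    | zero => intro _; simpa using h
    | succ i ih =>
      intro hi
      have h1 := pow_sub_one_dvd_derivative_of_pow_dvd (ih (by omega))
      have h2 : X * derivative (∑ c, C ((e c : R) ^ i) * X ^ e c) =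
          ∑ c, C ((e c : R) ^ (i + 1)) * X ^ e c := by
        rw [derivative_sum, Finset.mul_sum]
        refine Finset.sum_congr rfl fun c _ => ?_
        rw [derivative_C_mul_X_pow]
        rcases Nat.eq_zero_or_pos (e c) with h0 | h0
        · simp [h0]
        · obtain ⟨t, ht⟩ : ∃ t, e c = t + 1 := ⟨e c - 1, by omega⟩
          rw [ht, Nat.add_sub_cancel, pow_succ, pow_succ (X : R[X]) t]
          ring
      rw [← h2]
      exact (h1.mul_left X)
  have h1 := key j hj.le
  obtain ⟨Q, hQ⟩ := (dvd_pow_self (X - 1 : R[X]) (by omega : m - j ≠ 0)).trans h1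
  have := congrArg (eval 1) hQ
  simpa [eval_finsetSum] using this

/-- If `(∑ ζ ^ e c) ^ 2` is divisible by `p` among algebraic integers, where `ζ` is a primitive
`p ^ k`-th root of unity, then small power sums of the exponents vanish modulo `p`. -/
theorem sum_pow_eq_zero_of_sq_eq {p k : ℕ} [Fact p.Prime] (hk : 0 < k) {ζ : ℂ}
    (hζ : IsPrimitiveRoot ζ (p ^ k)) {ι : Type*} [Fintype ι] (e : ι → ℕ) {η : ℂ}
    (hη : IsIntegral ℤ η) (h : (∑ c, ζ ^ e c) ^ 2 = p * η) {j : ℕ}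
    (hj : 2 * j < p ^ k - p ^ (k - 1)) : ∑ c, (e c : ZMod p) ^ j = 0 := by
  have h1 := sub_one_pow_dvd_of_sq_eq hk hζ (∑ c, X ^ e c) hη (by simpa using h)
  refine sum_pow_eq_zero_of_dvd e (m := j + 1) (Nat.lt_succ_self j) ?_
  have h2 : (X - 1 : (ZMod p)[X]) ^ (2 * j + 1) ∣ (∑ c, X ^ e c) ^ 2 := by
    refine (pow_dvd_pow _ (by omega : 2 * j + 1 ≤ p ^ k - p ^ (k - 1))).trans ?_
    simpa [Polynomial.map_sum] using h1
  have hprime : Prime (X - 1 : (ZMod p)[X]) := by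
    rw [← C_1]; exact prime_X_sub_C 1
  generalize hP : (∑ c, X ^ e c : (ZMod p)[X]) = P at h2 ⊢
  by_cases hP0 : P = 0
  · rw [hP0]; exact dvd_zero _
  have hfin : FiniteMultiplicity (X - 1 : (ZMod p)[X]) P :=
    FiniteMultiplicity.of_prime_left hprime hP0
  have hfin2 : FiniteMultiplicity (X - 1 : (ZMod p)[X]) (P ^ 2) := hfin.pow hprime
  rw [hfin2.pow_dvd_iff_le_multiplicity, hfin.multiplicity_pow hprime] at h2
  rw [hfin.pow_dvd_iff_le_multiplicity]
  omega

end Cyclotomic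

/-! ### Explicit characters over the prime field. -/

section NonSupersingular

theorem IsLevelChar.mono {F : Type*} [Field F] {ℓ ℓ' : ℕ} {h : F[X] → ℂ}
    (hh : IsLevelChar ℓ h) (hle : ℓ ≤ ℓ') : IsLevelChar ℓ' h where
  map_one := hh.map_one
  map_mul := hh.map_mul
  congr f g hf hg e := hh.congr f g hf hg fun j hj => e j (hj.trans hle)

theorem evalChar_pow {F : Type*} [Field F] {ℓ : ℕ} (χ : LevelQuot F ℓ →* ℂˣ) {f : F[X]}
    (hf : f.Monic) (n : ℕ) : evalChar χ f ^ n = evalChar χ (f ^ n) := by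
  induction n with
  | zero => rw [pow_zero, pow_zero, (isLevelChar_evalChar χ).map_one]
  | succ n ih =>
    rw [pow_succ, pow_succ, (isLevelChar_evalChar χ).map_mul _ _ (hf.pow n) hf, ih]

theorem evalChar_pow_prime_pow_eq_one {p : ℕ} [Fact p.Prime] {F : Type*} [Field F] [CharP F p]
    {ℓ k : ℕ} (hk : ℓ < p ^ k) (χ : LevelQuot F ℓ →* ℂˣ) {f : F[X]} (hf : f.Monic) :
    evalChar χ f ^ p ^ k = 1 := by
  rw [evalChar_of_monic χ hf, ← Units.val_pow_eq_pow_val, ← map_pow, pow_eq_one_of_lt p hk]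
  simp

theorem evalChar_X {F : Type*} [Field F] {ℓ : ℕ} (χ : LevelQuot F ℓ →* ℂˣ) (n : ℕ) :
    evalChar χ (X ^ n : F[X]) = 1 := by
  have hχ := isLevelChar_evalChar χ
  rw [← hχ.map_one]
  refine hχ.congr _ _ (monic_X_pow n) monic_one fun j _ => ?_
  congr 1
  simpa using reverse_mul_X_pow (1 : F[X]) n

/-- A character of level `ℓ` whose value at `X + 1` has the largest possible order. -/
theorem exists_isPrimitiveRoot_evalChar (p : ℕ) [Fact p.Prime] {ℓ m : ℕ} (hm : p ^ m ≤ ℓ)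
    (hm' : ℓ < p ^ (m + 1)) : ∃ χ : LevelQuot (ZMod p) ℓ →* ℂˣ,
      IsPrimitiveRoot (evalChar χ (X + C 1)) (p ^ (m + 1)) := by
  have hmon : (X + C 1 : (ZMod p)[X]).Monic := monic_X_add_C 1
  have hpos : 0 < p ^ m := pow_pos (Fact.out : p.Prime).pos m
  have hpow : (X + C 1 : (ZMod p)[X]) ^ p ^ m = X ^ p ^ m + C 1 := by
    rw [add_pow_char_pow, C_1, one_pow]
  have hmon' : (X ^ p ^ m + C 1 : (ZMod p)[X]).Monic := hpow ▸ hmon.pow _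
  -- The `p ^ m`-th next-to-leading coefficient is 1 and is visible at level `ℓ ≥ p ^ m`. A
  -- character nontrivial on this power of `X + 1` gives `X + 1` a value of exact order `p ^ (m +
  -- 1)`.
  have hne : (((⟨_, hmon'⟩ : monics (ZMod p)) : LevelQuot (ZMod p) ℓ)) ≠ 1 := by
    rw [Ne, levelQuot_mk_eq_one]
    intro h
    have h1 := h ⟨p ^ m - 1, by omega⟩
    simp only [Nat.sub_add_cancel hpos] at h1
    rw [nextToLeadingCoeff, natDegree_X_pow_add_C, if_pos le_rfl, Nat.sub_self] at h1
    simp [hpos.ne] at h1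
  obtain ⟨χ, hχ⟩ :=
    CommGroup.exists_apply_ne_one_of_hasEnoughRootsOfUnity (LevelQuot (ZMod p) ℓ) ℂ hne
  refine ⟨χ, ?_⟩
  rw [← orderOf_eq_prime_pow (x := evalChar χ (X + C 1)) (p := p) (n := m) ?_
    (evalChar_pow_prime_pow_eq_one hm' χ hmon)]
  · exact IsPrimitiveRoot.orderOf _
  · rw [evalChar_pow χ hmon, hpow, evalChar_of_monic χ hmon']
    intro h
    exact hχ (Units.ext h)

theorem exists_levelChar_two : ∃ h : (ZMod 2)[X] → ℂ, IsLevelChar 4 h ∧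
    ∀ η, IsIntegral ℤ η → (∑ c, h (X + C c)) ^ 2 ≠ (2 : ℕ) * η := by
  obtain ⟨χ, hχ⟩ := exists_isPrimitiveRoot_evalChar 2 (ℓ := 4) (m := 2) (by norm_num) (by norm_num)
  refine ⟨evalChar χ, isLevelChar_evalChar χ, fun η hη h => ?_⟩
  have h0 := evalChar_X χ 1
  have hsum : ∑ c : ZMod 2, evalChar χ (X + C c) = ∑ i : Fin 2, evalChar χ (X + C 1) ^ (i : ℕ) := by
    have hs : ∀ f : ZMod 2 → ℂ, ∑ c, f c = f 0 + f 1 := fun f => Fin.sum_univ_two f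
    rw [hs, Fin.sum_univ_two, C_0, add_zero, ← pow_one (X : (ZMod 2)[X]), h0]
    simp
  rw [hsum] at h
  -- The sum is `1 + ζ` with `ζ` of order 8; its exponents 0 and 1 have odd sum, and `2 * 1 < 8 -
  -- 4`.
  have := sum_pow_eq_zero_of_sq_eq (by norm_num) hχ (fun i : Fin 2 => (i : ℕ)) hη h
    (j := 1) (by norm_num)
  simp [Fin.sum_univ_two] at this

theorem exists_levelChar_three : ∃ h : (ZMod 3)[X] → ℂ, IsLevelChar 3 h ∧
    ∀ η, IsIntegral ℤ η → (∑ c, h (X + C c)) ^ 2 ≠ (3 : ℕ) * η := by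
  obtain ⟨χ, hχ⟩ := exists_isPrimitiveRoot_evalChar 3 (ℓ := 3) (m := 1) (by norm_num) (by norm_num)
  refine ⟨evalChar χ, isLevelChar_evalChar χ, fun η hη h => ?_⟩
  have hl := isLevelChar_evalChar χ
  have h0 := evalChar_X χ 1
  have hm1 : (X + C 1 : (ZMod 3)[X]).Monic := monic_X_add_C 1
  have hm2 : (X + C 2 : (ZMod 3)[X]).Monic := monic_X_add_C 2
  have h9 : evalChar χ (X + C 2) ^ 3 ^ 2 = 1 :=
    evalChar_pow_prime_pow_eq_one (by norm_num) χ hm2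
  obtain ⟨m, -, hm⟩ := hχ.eq_pow_of_pow_eq_one h9
  -- The cube of `(X + 1) * (X + 2)` is `X ^ 6 + 2`, trivial at level 3. Hence `ζ ^ (3 * (m + 1)) =
  -- 1` with `ζ` of order 9, so `m ≡ -1` modulo 3.
  have hcube : (evalChar χ (X + C 1) * evalChar χ (X + C 2)) ^ 3 = 1 := by
    rw [← hl.map_mul _ _ hm1 hm2, evalChar_pow χ (hm1.mul hm2), ← hl.map_one]
    have hprod : ((X + C 1) * (X + C 2) : (ZMod 3)[X]) ^ 3 = X ^ 6 + C 2 := by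
      have e1 : ((X + C 1) * (X + C 2) : (ZMod 3)[X]) = X ^ 2 + C 2 := by
        have : (C 1 + C 2 : (ZMod 3)[X]) = 0 := by
          rw [← C_add, show (1 + 2 : ZMod 3) = 0 from rfl, C_0]
        have h2 : (C 1 * C 2 : (ZMod 3)[X]) = C 2 := by simp
        linear_combination (X : (ZMod 3)[X]) * this + h2
      rw [e1, add_pow_char, ← pow_mul, ← C_pow]
      rfl
    have hmon6 : (X ^ 6 + C 2 : (ZMod 3)[X]).Monic := by
      rw [← hprod]; exact (hm1.mul hm2).pow 3
    rw [hprod]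
    refine hl.congr _ _ hmon6 monic_one fun j hj => ?_
    rw [coeff_reverse_one, coeff_reverse_of_le (by rw [natDegree_X_pow_add_C]; omega),
      natDegree_X_pow_add_C, coeff_add, coeff_X_pow, coeff_C, if_neg (by omega : ¬ 6 - j = 0),
      add_zero]
    congr 1
    simp only [eq_iff_iff]
    omega
  have hmod : 3 ∣ m + 1 := by
    rw [← hm, ← pow_succ', ← pow_mul, hχ.pow_eq_one_iff_dvd] at hcube
    omega
  have hsum : ∑ c : ZMod 3, evalChar χ (X + C c) =
      ∑ i : Fin 3, evalChar χ (X + C 1) ^ (![0, 1, m] i) := by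
    have hs : ∀ f : ZMod 3 → ℂ, ∑ c, f c = f 0 + f 1 + f 2 := fun f => Fin.sum_univ_three f
    rw [hs, Fin.sum_univ_three, C_0, add_zero, ← pow_one (X : (ZMod 3)[X]), h0, pow_one, ← hm]
    simp
  rw [hsum] at h
  -- The squares of the exponents sum to `1 + m ^ 2 = 2` modulo 3, and `2 * 2 < 9 - 3`.
  have := sum_pow_eq_zero_of_sq_eq (by norm_num) hχ ![0, 1, m] hη h (j := 2) (by norm_num)
  rw [Fin.sum_univ_three] at this
  obtain ⟨t, ht⟩ := hmod
  have hm3 : (m : ZMod 3) = -1 := by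
    have : ((m + 1 : ℕ) : ZMod 3) = ((3 * t : ℕ) : ZMod 3) := by rw [ht]
    push_cast at this
    rw [show (3 : ZMod 3) = 0 from rfl, zero_mul] at this
    exact eq_neg_of_add_eq_zero_left this
  simp [hm3] at this
  revert this
  decide

/-- Composing `φ` with an additive character of `ZMod p` gives a level character with values `ζ ^
φ(f)`, to which the power-sum criterion applies with `k = 1`. -/
theorem exists_levelChar_of_additive {p : ℕ} [Fact p.Prime] {ℓ : ℕ} (φ : (ZMod p)[X] → ZMod p)
    (hone : φ 1 = 0) (hmul : ∀ f g, f.Monic → g.Monic → φ (f * g) = φ f + φ g)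
    (hcongr : ∀ f g, (∀ j ≤ ℓ, f.reverse.coeff j = g.reverse.coeff j) → φ f = φ g)
    {j : ℕ} (hj : 2 * j < p - 1) (hne : ∑ c : ZMod p, φ (X + C c) ^ j ≠ 0) :
    ∃ h : (ZMod p)[X] → ℂ, IsLevelChar ℓ h ∧
      ∀ η, IsIntegral ℤ η → (∑ c, h (X + C c)) ^ 2 ≠ p * η := by
  have hp0 : p ≠ 0 := (Fact.out : p.Prime).ne_zero
  have hζ := Complex.isPrimitiveRoot_exp p hp0
  set ζ := Complex.exp (2 * Real.pi * Complex.I / p)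
  refine ⟨fun f => ζ ^ (φ f).val, ⟨?_, ?_, ?_⟩, ?_⟩
  · simp [hone]
  · intro f g hf hg
    rw [hmul f g hf hg, ZMod.val_add, ← pow_add, ← pow_mod_orderOf ζ ((φ f).val + (φ g).val),
      ← hζ.eq_orderOf]
  · intro f g _ _ h
    rw [hcongr f g h]
  · intro η hη h
    apply hne
    have := sum_pow_eq_zero_of_sq_eq (k := 1) one_pos (by simpa using hζ)
      (fun c : ZMod p => (φ (X + C c)).val) hη h (j := j) (by simpa using hj)
    simpa using this

section Coeff

variable {F : Type*} [Field F]

theorem coeff_one_reverse_X_add_C (c : F) : (X + C c).reverse.coeff 1 = c := by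
  rw [coeff_one_reverse, nextCoeff_X_add_C]

theorem coeff_reverse_X_add_C (c : F) {j : ℕ} (hj : 2 ≤ j) : (X + C c).reverse.coeff j = 0 := by
  apply coeff_eq_zero_of_natDegree_lt
  have := reverse_natDegree_le (X + C c)
  rw [natDegree_X_add_C] at this
  omega

/-- A combination of the power sums of degrees `1` and `3`, in terms of the coefficients. -/
def cubicForm (b : F) (f : F[X]) : F :=
  let c := f.reverse.coeff
  c 1 ^ 3 - 3 * c 1 * c 2 + 3 * c 3 + b * c 1

/-- The power sum of degree `4`, up to sign, in terms of the coefficients. -/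
def quarticForm (f : F[X]) : F :=
  let c := f.reverse.coeff
  c 1 ^ 4 - 4 * c 1 ^ 2 * c 2 + 2 * c 2 ^ 2 + 4 * c 1 * c 3 - 4 * c 4

/-- Power sums of the roots add up under multiplication; in terms of coefficients this is a
polynomial identity. -/
theorem cubicForm_mul (b : F) {f g : F[X]} (hf : f.Monic) (hg : g.Monic) :
    cubicForm b (f * g) = cubicForm b f + cubicForm b g := by
  have h1 := coeff_zero_reverse_of_monic hf
  have h2 := coeff_zero_reverse_of_monic hg
  simp only [cubicForm, reverse_mul_of_domain, coeff_mul, Finset.Nat.antidiagonal_succ]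
  simp [h1, h2, -coeff_one_reverse, -coeff_zero_reverse]
  ring

theorem quarticForm_mul {f g : F[X]} (hf : f.Monic) (hg : g.Monic) :
    quarticForm (f * g) = quarticForm f + quarticForm g := by
  have h1 := coeff_zero_reverse_of_monic hf
  have h2 := coeff_zero_reverse_of_monic hg
  simp only [quarticForm, reverse_mul_of_domain, coeff_mul, Finset.Nat.antidiagonal_succ]
  simp [h1, h2, -coeff_one_reverse, -coeff_zero_reverse]
  ring

theorem cubicForm_X_add_C (b c : F) : cubicForm b (X + C c) = c ^ 3 + b * c := by
  simp only [cubicForm]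
  rw [coeff_one_reverse_X_add_C, coeff_reverse_X_add_C c le_rfl,
    coeff_reverse_X_add_C c (by norm_num : 2 ≤ 3)]
  ring

theorem quarticForm_X_add_C (c : F) : quarticForm (X + C c) = c ^ 4 := by
  simp only [quarticForm]
  rw [coeff_one_reverse_X_add_C, coeff_reverse_X_add_C c le_rfl,
    coeff_reverse_X_add_C c (by norm_num : 2 ≤ 3),
    coeff_reverse_X_add_C c (by norm_num : 2 ≤ 4)]
  ring

theorem cubicForm_one (b : F) : cubicForm b 1 = 0 := by
  simp [cubicForm, coeff_reverse_one, -coeff_one_reverse]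

theorem quarticForm_one : quarticForm (1 : F[X]) = 0 := by
  simp [quarticForm, coeff_reverse_one, -coeff_one_reverse]

end Coeff

theorem sum_pow_zmod (p : ℕ) [Fact p.Prime] {i : ℕ} (hi : i ≠ 0) :
    ∑ c : ZMod p, c ^ i = if p - 1 ∣ i then -1 else 0 := by
  classical
  have h := FiniteField.sum_pow_units (ZMod p) i
  rw [ZMod.card] at h
  rw [← h, ← Finset.sum_sdiff (Finset.subset_univ {0}), Finset.sum_singleton, zero_pow hi, add_zero]
  symm
  refine Finset.sum_bij (fun u _ => (u : ZMod p)) ?_ ?_ ?_ ?_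
  · intro u _; simp
  · intro a _ b _ h; exact Units.ext h
  · intro c hc
    have hc0 : c ≠ 0 := by simpa using hc
    exact ⟨Units.mk0 c hc0, Finset.mem_univ _, rfl⟩
  · intro u _; rfl

theorem exists_levelChar_five [Fact (Nat.Prime 5)] : ∃ h : (ZMod 5)[X] → ℂ, IsLevelChar 4 h ∧
    ∀ η, IsIntegral ℤ η → (∑ c, h (X + C c)) ^ 2 ≠ (5 : ℕ) * η := by
  refine exists_levelChar_of_additive quarticForm quarticForm_one (fun f g => quarticForm_mul)
    ?_ (j := 1) (by norm_num) ?_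
  · intro f g h
    simp only [quarticForm]
    rw [h 1 (by norm_num), h 2 (by norm_num), h 3 (by norm_num), h 4 le_rfl]
  · simp only [quarticForm_X_add_C, pow_one]
    rw [sum_pow_zmod 5 (by norm_num), if_pos (by norm_num)]
    exact neg_ne_zero.2 one_ne_zero

/-- The choice of `b` and `j` leaves exactly one monomial whose exponent is a positive multiple of
`p - 1`. For `p = 5` the second case would have `2 * j = p - 1`, just outside the allowed range. -/
theorem exists_sum_cubic_pow_ne_zero {p : ℕ} [Fact p.Prime] (hp : 7 ≤ p) :
    ∃ (b : ZMod p) (j : ℕ), 2 * j < p - 1 ∧ ∑ c : ZMod p, (c ^ 3 + b * c) ^ j ≠ 0 := by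
  have hpr : p.Prime := Fact.out
  have hmod : p % 3 = 1 ∨ p % 3 = 2 := by
    have : ¬ 3 ∣ p := fun h => by
      have := (Nat.prime_dvd_prime_iff_eq Nat.prime_three hpr).1 h
      omega
    omega
  rcases hmod with h | h
  · obtain ⟨j, hj⟩ : ∃ j, p - 1 = 3 * j := ⟨(p - 1) / 3, by omega⟩
    refine ⟨0, j, by omega, ?_⟩
    have e : ∀ c : ZMod p, (c ^ 3 + 0 * c) ^ j = c ^ (p - 1) := by
      intro c
      rw [zero_mul, add_zero, ← pow_mul, hj]
    simp only [e]
    rw [sum_pow_zmod p (by omega), if_pos dvd_rfl]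
    exact neg_ne_zero.2 one_ne_zero
  · obtain ⟨j, hj⟩ : ∃ j, p + 1 = 3 * j := ⟨(p + 1) / 3, by omega⟩
    refine ⟨1, j, by omega, ?_⟩
    have e : ∀ c : ZMod p, (c ^ 3 + 1 * c) ^ j =
        ∑ i ∈ Finset.range (j + 1), (j.choose i : ZMod p) * c ^ (j + 2 * i) := by
      intro c
      rw [add_pow]
      refine Finset.sum_congr rfl fun i hi => ?_
      have : i ≤ j := by simpa [Nat.lt_succ_iff] using hi
      rw [one_mul, ← pow_mul, ← pow_add, mul_comm]
      congr 2
      omega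
    simp only [e]
    -- The exponents `j + 2 * i` lie between `j` and `3 * j = p + 1`, so the only multiple of `p -
    -- 1` among them is `p - 1` itself, at `i = j - 1`. Its coefficient `j` is nonzero modulo `p`.
    rw [Finset.sum_comm, Finset.sum_eq_single (j - 1)]
    · rw [← Finset.mul_sum, sum_pow_zmod p (by omega), if_pos]
      · have hc : j.choose (j - 1) = j := by
          rw [Nat.choose_symm_of_eq_add (show j = (j - 1) + 1 by omega), Nat.choose_one_right]
        rw [hc, mul_neg, mul_one, neg_ne_zero, Ne, ZMod.natCast_eq_zero_iff]
        exact fun hd => absurd (Nat.le_of_dvd (by omega) hd) (by omega)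
      · exact dvd_of_eq (by omega)
    · intro i hi hne
      have : i ≤ j := by simpa [Nat.lt_succ_iff] using hi
      rw [← Finset.mul_sum, sum_pow_zmod p (by omega), if_neg, mul_zero]
      rintro ⟨t, ht⟩
      rcases t with _ | _ | t
      · omega
      · omega
      · have : (p - 1) * (t + 2) ≥ (p - 1) * 2 := Nat.mul_le_mul_left _ (by omega)
        have h3 : (p - 1) * (t + 1 + 1) = (p - 1) * (t + 2) := rfl
        omega
    · intro hnot
      exact absurd (Finset.mem_range.2 (by omega)) hnot

theorem exists_levelChar_of_seven_le {p : ℕ} [Fact p.Prime] (hp : 7 ≤ p) :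
    ∃ h : (ZMod p)[X] → ℂ, IsLevelChar 3 h ∧
      ∀ η, IsIntegral ℤ η → (∑ c, h (X + C c)) ^ 2 ≠ p * η := by
  obtain ⟨b, j, hj, hne⟩ := exists_sum_cubic_pow_ne_zero hp
  refine exists_levelChar_of_additive (cubicForm b) (cubicForm_one b)
    (fun f g => cubicForm_mul b) ?_ hj ?_
  · intro f g h
    simp only [cubicForm]
    rw [h 1 (by norm_num), h 2 (by norm_num), h 3 le_rfl]
  · simpa only [cubicForm_X_add_C] using hne

/-- A character over the prime field with an `L`-function that is not supersingular. -/
theorem exists_levelChar_not_sq_eq {p : ℕ} [hp : Fact p.Prime] {ℓ : ℕ}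
    (hℓ : (ℓ = 3 ∧ p ≠ 2 ∧ p ≠ 5) ∨ 4 ≤ ℓ) :
    ∃ h : (ZMod p)[X] → ℂ, IsLevelChar ℓ h ∧
      ∀ η, IsIntegral ℤ η → (∑ c, h (X + C c)) ^ 2 ≠ p * η := by
  have hpr := hp.out
  by_cases h2 : p = 2
  · subst h2
    obtain ⟨h, hh, hn⟩ := exists_levelChar_two
    exact ⟨h, hh.mono (by omega), hn⟩
  by_cases h3 : p = 3
  · subst h3
    obtain ⟨h, hh, hn⟩ := exists_levelChar_three
    exact ⟨h, hh.mono (by omega), hn⟩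
  by_cases h5 : p = 5
  · subst h5
    obtain ⟨h, hh, hn⟩ := exists_levelChar_five
    exact ⟨h, hh.mono (by omega), hn⟩
  have h7 : 7 ≤ p := by
    by_contra hlt
    have := hpr.two_le
    interval_cases p <;> first | omega | exact absurd hpr (by norm_num)
  obtain ⟨h, hh, hn⟩ := exists_levelChar_of_seven_le h7
  exact ⟨h, hh.mono (by omega), hn⟩

end NonSupersingular

/-! ### Consequences of periodicity. -/

section Periodicity

theorem card_pow_mul_normalizedPsi {F : Type*} [Field F] [Fintype F] {ℓ : ℕ} {S : Multiset ℂ}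
    (hS : ∀ n, 1 ≤ n → (Fintype.card F : ℂ) ^ ℓ * psi F n (fun _ : Fin ℓ => (0 : F)) =
      mangoldtSum (fun _ : F[X] => 1) n - (S.map fun γ => γ ^ n).sum) (n : ℕ+) :
    (Fintype.card F : ℂ) ^ ℓ * normalizedPsi F ℓ n =
      -(S.map fun γ => (γ / ((√(Fintype.card F : ℝ) : ℝ) : ℂ)) ^ (n : ℕ)).sum := by
  have hq : (Fintype.card F : ℂ) ≠ 0 := Nat.cast_ne_zero.2 Fintype.card_ne_zero
  have h1 := hS n n.pos
  rw [mangoldtSum_const_one F n.pos] at h1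
  have h2 : (((Fintype.card F : ℝ) ^ (((n : ℕ) : ℝ) / 2) : ℝ) : ℂ) =
      ((√(Fintype.card F : ℝ) : ℝ) : ℂ) ^ (n : ℕ) := by
    rw [← Complex.ofReal_pow, Real.sqrt_eq_rpow, ← Real.rpow_natCast, ← Real.rpow_mul (by positivity)]
    congr 2
    ring
  have h3 : (S.map fun γ => (γ / ((√(Fintype.card F : ℝ) : ℝ) : ℂ)) ^ (n : ℕ)).sum =
      (S.map fun γ => γ ^ (n : ℕ)).sum / ((√(Fintype.card F : ℝ) : ℝ) : ℂ) ^ (n : ℕ) := by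
    simp only [div_pow]
    rw [Multiset.sum_map_div]
  rw [normalizedPsi, h2, h3, ← mul_div_assoc, ← neg_div]
  congr 1
  rw [mul_sub, h1, zpow_sub₀ hq, zpow_natCast, zpow_natCast, mul_div_cancel₀ _ (pow_ne_zero ℓ hq)]
  ring

/-- Subtracting the values at `n` and `n + N` gives a vanishing combination of the sequences `δ ^
n`, `δ = γ / √q`, with coefficients `δ ^ N - 1`. -/
theorem pow_eq_of_periodic {F : Type*} [Field F] [Fintype F] {ℓ : ℕ} {N : ℕ+}
    (hper : Function.Periodic (normalizedPsi F ℓ) N) {S : Multiset ℂ} (hS0 : 0 ∉ S)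
    (hS : ∀ n, 1 ≤ n → (Fintype.card F : ℂ) ^ ℓ * psi F n (fun _ : Fin ℓ => (0 : F)) =
      mangoldtSum (fun _ : F[X] => 1) n - (S.map fun γ => γ ^ n).sum) :
    ∀ γ ∈ S, γ ^ (N : ℕ) = ((√(Fintype.card F : ℝ) : ℝ) : ℂ) ^ (N : ℕ) := by
  set s := ((√(Fintype.card F : ℝ) : ℝ) : ℂ) with hs
  have hs0 : s ≠ 0 := by
    rw [hs, Complex.ofReal_ne_zero]
    exact Real.sqrt_ne_zero'.2 (by exact_mod_cast Fintype.card_pos)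
  intro γ hγ
  have hT0 : (0 : ℂ) ∉ S.map fun γ => γ / s := by
    intro h
    obtain ⟨x, hx, e⟩ := Multiset.mem_map.1 h
    rw [div_eq_zero_iff, or_iff_left hs0] at e
    exact hS0 (e ▸ hx)
  have key := eq_zero_of_sum_mul_pow_eq_zero (S.map fun γ => γ / s) hT0
    (fun δ => δ ^ (N : ℕ) - 1) ?_ (γ / s) (Multiset.mem_map_of_mem _ hγ)
  · rw [div_pow, sub_eq_zero, div_eq_one_iff_eq (pow_ne_zero _ hs0)] at key
    exact key
  · intro n hn
    have h1 := card_pow_mul_normalizedPsi hS ⟨n, hn⟩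
    have h2 := card_pow_mul_normalizedPsi hS (⟨n, hn⟩ + N)
    have h3 : normalizedPsi F ℓ (⟨n, hn⟩ + N) = normalizedPsi F ℓ ⟨n, hn⟩ := hper ⟨n, hn⟩
    rw [h3, h1, neg_inj] at h2
    rw [Multiset.map_map]
    simp only [Function.comp_apply, sub_mul, one_mul, ← pow_add]
    rw [Multiset.sum_map_sub, sub_eq_zero, add_comm (N : ℕ) n]
    exact h2.symm

/-- If `f_{q,ℓ}` is periodic, then every character over the prime field is supersingular. -/
theorem exists_sq_eq_of_periodic {p : ℕ} [Fact p.Prime] {F : Type*} [Field F] [Fintype F]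
    [CharP F p] {ℓ : ℕ} {N : ℕ+} (hper : Function.Periodic (normalizedPsi F ℓ) N)
    {h : (ZMod p)[X] → ℂ} (hh : IsLevelChar ℓ h) :
    ∃ η : ℂ, IsIntegral ℤ η ∧ (∑ c, h (X + C c)) ^ 2 = p * η := by
  by_cases htriv : ∀ g : (ZMod p)[X], g.Monic → h g = 1
  · refine ⟨p, isIntegral_algebraMap (R := ℤ) (x := (p : ℤ)), ?_⟩
    simp [htriv _ (monic_X_add_C _), ZMod.card, sq]
  push Not at htriv
  obtain ⟨g, hg, hne⟩ := htriv
  let := ZMod.algebra F p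
  set r := Module.finrank (ZMod p) F with hr
  have hrpos : 0 < r := Module.finrank_pos
  have hcard : Fintype.card F = p ^ r := by
    rw [Module.card_eq_pow_finrank (K := ZMod p), ZMod.card]
  obtain ⟨S, hS0, hS, hSh⟩ := exists_multiset_psi F ℓ
  obtain ⟨s₀, hs₀0, hs₀⟩ := exists_mangoldtSum_eq hh hg hne
  have hpow := pow_eq_of_periodic hper hS0 hS
  have hbase : ∀ n, 1 ≤ n → mangoldtSum (fun g : F[X] => h (normPoly (ZMod p) g)) n =
      -((s₀.map fun γ => γ ^ r).map fun δ => δ ^ n).sum := by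
    intro n hn
    rw [mangoldtSum_comp_normPoly p F h hn, hs₀ _ (Nat.mul_pos hrpos hn), Multiset.map_map]
    simp only [Function.comp_apply, ← pow_mul]
  have hs₀r : (0 : ℂ) ∉ s₀.map fun γ => γ ^ r := by
    intro h0
    obtain ⟨x, hx, e⟩ := Multiset.mem_map.1 h0
    exact hs₀0 (pow_eq_zero_iff hrpos.ne' |>.1 e ▸ hx)
  -- If the pullback were trivial, `q ^ n` plus the sum of the `γ ^ (r * n)` would vanish for all `n
  -- ≥ 1`, a combination with all coefficients 1.
  have hnt : ∃ g : F[X], g.Monic ∧ h (normPoly (ZMod p) g) ≠ 1 := by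
    by_contra! hall
    have hq0 : (0 : ℂ) ∉ (Fintype.card F : ℂ) ::ₘ s₀.map fun γ => γ ^ r := by
      rw [Multiset.mem_cons, not_or]
      exact ⟨(Nat.cast_ne_zero.2 Fintype.card_ne_zero).symm, hs₀r⟩
    refine one_ne_zero (eq_zero_of_sum_mul_pow_eq_zero _ hq0 (fun _ => 1) ?_ _
      (Multiset.mem_cons_self _ _))
    intro n hn
    have h1 := hbase n hn
    rw [mangoldtSum_congr hall, mangoldtSum_const_one F hn] at h1
    simp only [one_mul, Multiset.map_cons, Multiset.sum_cons]
    rw [h1]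
    ring
  obtain ⟨s₁, hs₁S, hs₁⟩ := hSh _ hh.comp_normPoly hnt
  set s := ((√(Fintype.card F : ℝ) : ℝ) : ℂ) with hs
  set t := ((√(p : ℝ) : ℝ) : ℂ) with ht
  have hst : s = t ^ r := by
    have hsqrt : √((p : ℝ) ^ r) = √(p : ℝ) ^ r := by
      rw [Real.sqrt_eq_iff_mul_self_eq (by positivity) (by positivity), ← mul_pow,
        Real.mul_self_sqrt (by positivity)]
    rw [hs, ht, hcard, ← Complex.ofReal_pow, Nat.cast_pow, hsqrt]
  have ht2 : t ^ 2 = p := by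
    rw [ht, ← Complex.ofReal_pow, Real.sq_sqrt (by positivity)]
    simp
  have ht0 : t ≠ 0 := by
    intro h0
    rw [h0] at ht2
    rw [zero_pow two_ne_zero, eq_comm, Nat.cast_eq_zero] at ht2
    exact (Fact.out : p.Prime).ne_zero ht2
  -- The power sums of `s₁` scale by `s ^ N` when `n` grows by `N`. Those of the `γ ^ r` are the
  -- same numbers, so independence gives `(γ ^ r) ^ N = s ^ N` without identifying the two
  -- multisets.
  have hroot : ∀ γ ∈ s₀, (γ / t) ^ (r * (N : ℕ)) = 1 := by
    intro γ hγ
    have key := eq_zero_of_sum_mul_pow_eq_zero _ hs₀r (fun δ => δ ^ (N : ℕ) - s ^ (N : ℕ)) ?_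
      (γ ^ r) (Multiset.mem_map_of_mem _ hγ)
    · rw [div_pow, div_eq_one_iff_eq (pow_ne_zero _ ht0), pow_mul, pow_mul, ← hst]
      exact sub_eq_zero.1 key
    · intro n hn
      have e1 := hbase n hn
      have e2 := hbase (n + N) (by omega)
      rw [hs₁ n hn, neg_inj] at e1
      rw [hs₁ (n + N) (by omega), neg_inj] at e2
      have e3 : (s₁.map fun γ => γ ^ (n + (N : ℕ))).sum =
          s ^ (N : ℕ) * (s₁.map fun γ => γ ^ n).sum := by
        rw [← Multiset.sum_map_mul_left]
        refine congrArg _ (Multiset.map_congr rfl fun x hx => ?_)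
        rw [pow_add, hpow x (Multiset.mem_of_le hs₁S hx), mul_comm]
      simp only [sub_mul, ← pow_add]
      rw [Multiset.sum_map_sub, Multiset.sum_map_mul_left, ← e1, ← e3, e2, add_comm (N : ℕ) n,
        sub_self]
  -- A sum of roots of unity is integral, and `t ^ 2 = p` supplies the factor `p`.
  refine ⟨(s₀.map fun γ => γ / t).sum ^ 2, ?_, ?_⟩
  · refine IsIntegral.pow (IsIntegral.multiset_sum fun x hx => ?_) 2
    obtain ⟨γ, hγ, rfl⟩ := Multiset.mem_map.1 hx
    refine IsIntegral.of_pow (Nat.mul_pos hrpos N.pos) ?_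
    rw [hroot γ hγ]
    exact isIntegral_one
  · rw [← mangoldtSum_one, hs₀ 1 le_rfl, Multiset.sum_map_div, div_pow, ht2]
    have hp0 : (p : ℂ) ≠ 0 := Nat.cast_ne_zero.2 (Fact.out : p.Prime).ne_zero
    simp only [pow_one, neg_sq, Multiset.map_id']
    field_simp

end Periodicity

end ShortInterval

end

theorem theorem3 (p r : ℕ) (hp : p.Prime) (F : Type*) [Field F] [Fintype F]
    (hF : Fintype.card F = p ^ r) (ℓ : ℕ)
    (hℓ : (ℓ = 3 ∧ p ≠ 2 ∧ p ≠ 5) ∨ 4 ≤ ℓ) :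
    ¬ ∃ N : ℕ+, Function.Periodic (ShortInterval.normalizedPsi F ℓ) N := by
  rintro ⟨N, hper⟩
  have : Fact p.Prime := ⟨hp⟩
  have : CharP F p := charP_of_card_eq_prime_pow hF
  obtain ⟨h, hh, hne⟩ := ShortInterval.exists_levelChar_not_sq_eq (p := p) hℓ
  obtain ⟨η, hη, e⟩ := ShortInterval.exists_sq_eq_of_periodic (p := p) hper hh
  exact hne η hη e
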